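/- Let $m\ge 1$ be an integer. Let $\mathcal{C}\ell_m^{\mathbb R}$ and $\mathcal{C}\ell_m^{\mathbb C}$ be the real and the complex Clifford algebra with generators $e_1,\dots,e_m$, $e_ie_j+e_je_i=0$ for $i\ne j$ and $e_j^2=-1$. For $a=\sum_A a_Ae_A$ put $a^\dagger=\sum_A \overline{a_A}\,(-1)^{|A|(|A|+1)/2}e_A$ and $|a|_0^2=\sum_A|a_A|^2$. For a measure $\mu$, the right Clifford module $L^2(\mu)$ of square-integrable Clifford algebra-valued functions carries the Clifford algebra-valued inner product $\langle F,G\rangle=\int F^\dagger G\,d\mu$. A family $(\psi_i)$ in $L^2(\mu)$ is orthonormal if $\langle\psi_i,\psi_{i'}\rangle=\delta_{i,i'}$; it is an orthonormal basis of a closed right submodule $M$ if moreover all $\psi_i$ lie in $M$ and $F=\sum_i\psi_i\langle\psi_i,F\rangle$ (unconditional convergence in norm) for every $F\in M$. Let $D=\sum_j e_j\partial_{x_j}$ be the Dirac operator. For $k\in\mathbb N_0$ let $M_l^+(k)$ be the right $\mathcal{C}\ell_m^{\mathbb R}$-module of left inner spherical monogenics of order $k$, i.e. of the homogeneous polynomials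 $P:\mathbb R^m\to\mathcal{C}\ell_m^{\mathbb R}$ of degree $k$ with $DP=0$, with the inner product $\frac{1}{|S^{m-1}|}\int_{S^{m-1}}P^\dagger Q\,dS$, and let $P_k^{(1)},\dots,P_k^{(d_k)}$ be an orthonormal basis of the right module $M_l^+(k)$. A polynomial $P$ on $\mathbb R^m$ is extended to $\mathbb C^m$ by inserting $z\in\mathbb C^m$; $\underline z=\sum_j z_je_j$. For $p,k\in\mathbb N_0$ put $$\gamma_{2p,k}=\frac{2^{2p+m/2+k}\,p!\,\sqrt{\pi}^{\,m}\,\Gamma(\frac m2+k+p)}{\Gamma(\frac m2)},\qquad \gamma_{2p+1,k}=\frac{2^{2p+m/2+k+1}\,p!\,\sqrt{\pi}^{\,m}\,\Gamma(\frac m2+k+p+1)}{\Gamma(\frac m2)}.$$ Let the Segal–Bargmann module $\mathcal F^2(\mathbb C^m,\mathcal{C}\ell_m^{\mathbb C})$ be the closure, in $L^2(\mathbb C^m,\pi^{-m}e^{-|z|^2}dx\,dy,\mathcal{C}\ell_m^{\mathbb C})$, of the right $\mathcal{C}\ell_m^{\mathbb C}$-module spanned by the functions $\underline z^{\,l}P(z)$,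 $l,k\in\mathbb N_0$, $P\in M_l^+(k)$. Let $$(\mathcal Bf)(z)=\frac{1}{(2\pi)^{m/2}}\int_{\mathbb R^m}e^{-\frac{z\cdot z}{2}+x\cdot z-\frac{x\cdot x}{4}}f(x)\,dx,\qquad x\cdot z=\sum_j x_jz_j,$$ be the Segal–Bargmann transform, and let $$\phi_{l,k,j}(x)=\frac{1}{\sqrt{\gamma_{l,k}}}\,e^{-\frac{|x|^2}{4}}\cdot(-1)^l e^{\frac{|x|^2}{2}}D^l\!\left(e^{-\frac{|x|^2}{2}}P_k^{(j)}(x)\right)$$ be the Clifford–Hermite functions. Then: (1) the functions $$\sqrt{\frac{(2\pi)^{m/2}}{\gamma_{l,k}}}\;\underline z^{\,l}P_k^{(j)}(z),\qquad l,k\in\mathbb N_0,\ 1\le j\le d_k,$$ form an orthonormal basis of the Segal–Bargmann module $\mathcal F^2(\mathbb C^m,\mathcal{C}\ell_m^{\mathbb C})$; (2) the functions $\phi_{l,k,j}$ are orthonormal in $L^2(\mathbb R^m,\mathcal{C}\ell_m^{\mathbb R})$, $(\mathcal B\phi_{l,k,j})(z)=\gamma_{l,k}^{-1/2}\,\underline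 z^{\,l}P_k^{(j)}(z)$ for all $z\in\mathbb C^m$, and the functions $(2\pi)^{m/4}\,\mathcal B\phi_{l,k,j}$ are the orthonormal basis in (1). -/

import Mathlib

open MeasureTheory

noncomputable section

namespace SegalBargmann

/-! ### The real and complex Clifford algebras -/

/-- The quadratic form `v ↦ - ∑ vⱼ ^ 2` on `𝕜 ^ m`. -/
def negSumSq (𝕜 : Type) [RCLike 𝕜] (m : ℕ) : QuadraticForm 𝕜 (Fin m → 𝕜) :=
  QuadraticMap.weightedSumSquares 𝕜 (fun _ : Fin m => (-1 : 𝕜))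

/-- The Clifford algebra over `𝕜 = ℝ` or `𝕜 = ℂ` with `m` generators that satisfy
`eᵢ eⱼ + eⱼ eᵢ = 0` for `i ≠ j` and `eⱼ ^ 2 = -1`. -/
def Cl (𝕜 : Type) [RCLike 𝕜] (m : ℕ) : Type := CliffordAlgebra (negSumSq 𝕜 m)

section Algebra

variable (𝕜 : Type) [RCLike 𝕜] (m : ℕ)

instance : Ring (Cl 𝕜 m) := inferInstanceAs (Ring (CliffordAlgebra (negSumSq 𝕜 m)))

instance : Algebra 𝕜 (Cl 𝕜 m) :=
  inferInstanceAs (Algebra 𝕜 (CliffordAlgebra (negSumSq 𝕜 m)))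

variable {m}

/-- The generator `eⱼ`. -/
def gen (j : Fin m) : Cl 𝕜 m := CliffordAlgebra.ι (negSumSq 𝕜 m) (Pi.single j 1)

/-- The blade `e_A = e_{n₁} ⋯ e_{nₗ}` for `A = {n₁ < ⋯ < nₗ}`. -/
def blade (A : Finset (Fin m)) : Cl 𝕜 m :=
  (List.ofFn fun i : Fin A.card => gen 𝕜 (A.orderEmbOfFin rfl i)).prod

variable (m)

/-- The basis of the Clifford algebra that corresponds to the standard basis of the exterior
algebra; its elements are the blades, see `bladeBasis_apply`. -/
def bladeBasis : Module.Basis (Finset (Fin m)) 𝕜 (Cl 𝕜 m) :=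
  letI : Invertible (2 : 𝕜) := invertibleOfNonzero two_ne_zero
  ((Pi.basisFun 𝕜 (Fin m)).ExteriorAlgebra).map
    (CliffordAlgebra.equivExterior (negSumSq 𝕜 m)).symm

theorem contractLeft_list_prod {R M I : Type*} [CommRing R] [AddCommGroup M] [Module R M]
    (Q : QuadraticForm R M) (v : I → M) (d : Module.Dual R M) (l : List I)
    (h : ∀ j ∈ l, d (v j) = 0) :
    CliffordAlgebra.contractLeft (Q := Q) d (l.map fun j => CliffordAlgebra.ι Q (v j)).prod = 0 := by
  induction l with
  | nil => simp
  | cons i l ih =>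
    rw [List.map_cons, List.prod_cons, CliffordAlgebra.contractLeft_ι_mul,
      ih fun j hj => h j (List.mem_cons_of_mem _ hj), h i List.mem_cons_self]
    simp

theorem changeForm_list_prod {R M I : Type*} [CommRing R] [AddCommGroup M] [Module R M]
    {Q Q' : QuadraticForm R M} {B : LinearMap.BilinForm R M}
    (h : B.toQuadraticMap = Q' - Q) (v : I → M) (hB : ∀ i j, i ≠ j → B (v i) (v j) = 0)
    (l : List I) (hl : l.Nodup) :
    CliffordAlgebra.changeForm h (l.map fun j => CliffordAlgebra.ι Q (v j)).prod =
      (l.map fun j => CliffordAlgebra.ι Q' (v j)).prod := by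
  induction l with
  | nil => simp
  | cons i l ih =>
    rw [List.nodup_cons] at hl
    rw [List.map_cons, List.prod_cons, CliffordAlgebra.changeForm_ι_mul, ih hl.2,
      contractLeft_list_prod, List.map_cons, List.prod_cons, sub_zero]
    intro j hj
    exact hB i j fun hij => hl.1 (hij ▸ hj)

theorem bladeBasis_apply (A : Finset (Fin m)) : bladeBasis 𝕜 m A = blade 𝕜 A := by
  let _ : Invertible (2 : 𝕜) := invertibleOfNonzero two_ne_zero
  change (CliffordAlgebra.equivExterior (negSumSq 𝕜 m)).symm
    ((Pi.basisFun 𝕜 (Fin m)).ExteriorAlgebra A) = _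
  refine (LinearEquiv.symm_apply_eq _).2 ?_
  have hnd : (List.ofFn fun i : Fin A.card => A.orderEmbOfFin rfl i).Nodup :=
    List.nodup_ofFn.2 (A.orderEmbOfFin rfl).injective
  have key := changeForm_list_prod
    (CliffordAlgebra.changeForm.associated_neg_proof (Q := negSumSq 𝕜 m))
    (fun j : Fin m => (Pi.single j 1 : Fin m → 𝕜)) (fun i j hij => ?_) _ hnd
  · rw [List.map_ofFn, List.map_ofFn] at key
    rw [ExteriorAlgebra.basis_apply]
    refine (ExteriorAlgebra.ιMulti_apply _).trans (Eq.trans ?_ key.symm)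
    congr 2
    funext i
    simp [Set.powersetCard.ofFinEmbEquiv_symm_apply]
  · have h0 : ∀ k : Fin m, (Pi.single i 1 : Fin m → 𝕜) k * (Pi.single j 1 : Fin m → 𝕜) k = 0 := by
      intro k
      by_cases hk : k = i
      · subst hk; simp [Pi.single_eq_of_ne hij]
      · simp [Pi.single_eq_of_ne hk]
    have h1 : QuadraticMap.polar (-negSumSq 𝕜 m) (Pi.single i 1) (Pi.single j 1) = 0 := by
      simp only [QuadraticMap.polar, negSumSq, neg_apply,
        QuadraticMap.weightedSumSquares_apply, Pi.add_apply, ← Finset.sum_neg_distrib,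
        ← Finset.sum_sub_distrib]
      refine Finset.sum_eq_zero fun k _ => ?_
      simp only [smul_eq_mul]
      linear_combination 2 * h0 k
    rw [QuadraticMap.associated_apply, ← QuadraticMap.polar, h1, smul_zero]

/-- The Hilbert space of coefficients `(a_A)_A`. -/
def coeffs : Cl 𝕜 m ≃ₗ[𝕜] EuclideanSpace 𝕜 (Finset (Fin m)) :=
  (bladeBasis 𝕜 m).equivFun ≪≫ₗ (WithLp.linearEquiv 2 𝕜 (Finset (Fin m) → 𝕜)).symm

/-- The norm `|a|₀ = (∑ |a_A| ^ 2) ^ (1 / 2)`. -/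
instance : NormedAddCommGroup (Cl 𝕜 m) :=
  NormedAddCommGroup.induced (Cl 𝕜 m) (EuclideanSpace 𝕜 (Finset (Fin m))) (coeffs 𝕜 m)
    (coeffs 𝕜 m).injective

instance : NormedSpace 𝕜 (Cl 𝕜 m) :=
  NormedSpace.induced 𝕜 (Cl 𝕜 m) (EuclideanSpace 𝕜 (Finset (Fin m))) (coeffs 𝕜 m)

instance : FiniteDimensional 𝕜 (Cl 𝕜 m) := (bladeBasis 𝕜 m).finiteDimensional_of_finite

variable {𝕜 m}

/-- The involution `a ↦ ∑ conj(a_A) (-1) ^ (|A| (|A| + 1) / 2) e_A`. For `𝕜 = ℝ` it is the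
conjugation of the real Clifford algebra, for `𝕜 = ℂ` the involution `†` of the complex one. -/
def dagger (a : Cl 𝕜 m) : Cl 𝕜 m :=
  ∑ A : Finset (Fin m),
    (starRingEnd 𝕜 ((bladeBasis 𝕜 m).repr a A) * (-1) ^ (A.card * (A.card + 1) / 2)) • blade 𝕜 A

/-- The Clifford vector `∑ vⱼ eⱼ`. -/
def vec (v : Fin m → 𝕜) : Cl 𝕜 m := ∑ j, v j • gen 𝕜 j

/-- The inclusion of the real into the complex Clifford algebra. -/
def complexify (a : Cl ℝ m) : Cl ℂ m :=
  ∑ A : Finset (Fin m), (((bladeBasis ℝ m).repr a A : ℝ) : ℂ) • blade ℂ A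

/-- Multiplication by `a` from the right. -/
def mulRightCLM (a : Cl 𝕜 m) : Cl 𝕜 m →L[𝕜] Cl 𝕜 m :=
  LinearMap.toContinuousLinearMap (LinearMap.mulRight 𝕜 a)

end Algebra

/-! ### Hilbert Clifford modules of square-integrable functions -/

section Modules

variable {𝕜 : Type} [RCLike 𝕜] {m : ℕ} {X : Type} [MeasurableSpace X]

/-- The Clifford algebra-valued inner product `⟨F, G⟩ = ∫ F† G dμ`. -/
def cliffordInner [NormedSpace ℝ (Cl 𝕜 m)] (μ : Measure X) (F G : X → Cl 𝕜 m) : Cl 𝕜 m :=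
  ∫ x, dagger (F x) * G x ∂μ

/-- The right module structure on `L²`: the function `x ↦ F x * a`. -/
def rightMul {μ : Measure X} (F : Lp (Cl 𝕜 m) 2 μ) (a : Cl 𝕜 m) : Lp (Cl 𝕜 m) 2 μ :=
  (mulRightCLM a).compLp F

/-- A family in `L²(X, μ, Cl)` is orthonormal if its Clifford algebra-valued Gram matrix is the
identity. -/
def IsOrthonormalFamily [NormedSpace ℝ (Cl 𝕜 m)] {I : Type} [DecidableEq I] {μ : Measure X}
    (Ψ : I → Lp (Cl 𝕜 m) 2 μ) : Prop :=
  ∀ i j, cliffordInner μ (Ψ i) (Ψ j) = if i = j then 1 else 0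

/-- An orthonormal basis of a submodule `M` of `L²(X, μ, Cl)`: an orthonormal family in `M` such
that every `F ∈ M` has the norm convergent expansion `F = ∑ᵢ Ψᵢ ⟨Ψᵢ, F⟩`. -/
structure IsOrthonormalBasis [NormedSpace ℝ (Cl 𝕜 m)] {I : Type} [DecidableEq I] {μ : Measure X}
    (M : Submodule 𝕜 (Lp (Cl 𝕜 m) 2 μ)) (Ψ : I → Lp (Cl 𝕜 m) 2 μ) : Prop where
  mem : ∀ i, Ψ i ∈ M
  orthonormal : IsOrthonormalFamily Ψ
  hasSum : ∀ F ∈ M, HasSum (fun i => rightMul (Ψ i) (cliffordInner μ (Ψ i) F)) F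

end Modules

/-! ### Inner spherical monogenics -/

section Monogenics

variable {m : ℕ}

/-- A Clifford polynomial `∑ P_A e_A` in `m` variables with real scalar polynomials `P_A`, that
is, an element of the tensor product of the scalar polynomials with the real Clifford algebra. -/
abbrev CliffordPoly (m : ℕ) : Type := Finset (Fin m) → MvPolynomial (Fin m) ℝ

/-- The function `x ↦ P(x)` on `ℝ ^ m`. -/
def CliffordPoly.evalReal (P : CliffordPoly m) (x : EuclideanSpace ℝ (Fin m)) : Cl ℝ m :=
  ∑ A, MvPolynomial.eval (fun j => x j) (P A) • blade ℝ A

/-- The function `z ↦ P(z)` on `ℂ ^ m`. -/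
def CliffordPoly.evalComplex (P : CliffordPoly m) (z : Fin m → ℂ) : Cl ℂ m :=
  ∑ A, MvPolynomial.aeval z (P A) • blade ℂ A

/-- The Dirac operator `D f = ∑ⱼ eⱼ ∂f / ∂xⱼ`. -/
def dirac (f : EuclideanSpace ℝ (Fin m) → Cl ℝ m) (x : EuclideanSpace ℝ (Fin m)) : Cl ℝ m :=
  ∑ j, gen ℝ j * lineDeriv ℝ f x (EuclideanSpace.single j 1)

/-- The left inner spherical monogenics of order `k`: the homogeneous Clifford polynomials of
degree `k` that are annihilated by the Dirac operator acting from the left. -/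
def monogenics (m k : ℕ) : Set (CliffordPoly m) :=
  {P | (∀ A, (P A).IsHomogeneous k) ∧ ∀ x, dirac P.evalReal x = 0}

/-- The normalized surface measure on the unit sphere of `ℝ ^ m`. -/
def sphereMeasure (m : ℕ) : Measure (Metric.sphere (0 : EuclideanSpace ℝ (Fin m)) 1) :=
  ((volume : Measure (EuclideanSpace ℝ (Fin m))).toSphere Set.univ)⁻¹ •
    (volume : Measure (EuclideanSpace ℝ (Fin m))).toSphere

/-- The Clifford algebra-valued inner product of Clifford polynomials: the mean value of
`conj(P) Q` over the unit sphere. -/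
def sphereInner (P Q : CliffordPoly m) : Cl ℝ m :=
  cliffordInner (sphereMeasure m) (fun x => P.evalReal x) (fun x => Q.evalReal x)

/-- A finite orthonormal basis of the right module of inner spherical monogenics of order `k`. -/
structure IsMonogenicBasis {d : ℕ} (k : ℕ) (P : Fin d → CliffordPoly m) : Prop where
  mem : ∀ j, P j ∈ monogenics m k
  orthonormal : ∀ i j, sphereInner (P i) (P j) = if i = j then 1 else 0
  span : ∀ Q ∈ monogenics m k, ∃ a : Fin d → Cl ℝ m,
    ∀ x, Q.evalReal x = ∑ j, (P j).evalReal x * a j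

end Monogenics

/-! ### Clifford-Hermite functions -/

section Hermite

variable {m : ℕ}

/-- The constants `γ_{l,k}`, with `l = 2 p` or `l = 2 p + 1`:
`γ_{2p,k} = 2 ^ (2p + m/2 + k) p! √π ^ m Γ(m/2 + k + p) / Γ(m/2)` and
`γ_{2p+1,k} = 2 ^ (2p + m/2 + k + 1) p! √π ^ m Γ(m/2 + k + p + 1) / Γ(m/2)`. -/
def hermiteGamma (m l k : ℕ) : ℝ :=
  let p : ℕ := l / 2
  if Even l then
    (2 : ℝ) ^ (2 * p + (m : ℝ) / 2 + k) * p.factorial * √Real.pi ^ m *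
      Real.Gamma ((m : ℝ) / 2 + k + p) / Real.Gamma ((m : ℝ) / 2)
  else
    (2 : ℝ) ^ (2 * p + (m : ℝ) / 2 + k + 1) * p.factorial * √Real.pi ^ m *
      Real.Gamma ((m : ℝ) / 2 + k + p + 1) / Real.Gamma ((m : ℝ) / 2)

/-- The function `H_{l,m,k} P = (-1) ^ l exp(|x|² / 2) D ^ l (exp(-|x|² / 2) P)`. -/
def hermitePoly (l : ℕ) (P : CliffordPoly m) (x : EuclideanSpace ℝ (Fin m)) : Cl ℝ m :=
  ((-1) ^ l * Real.exp (‖x‖ ^ 2 / 2)) •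
    (dirac^[l] fun y => Real.exp (-‖y‖ ^ 2 / 2) • P.evalReal y) x

/-- The Clifford-Hermite function `γ_{l,k} ^ (-1/2) H_{l,m,k}(x) P(x) exp(-|x|² / 4)`, for an inner
spherical monogenic `P` of order `k`. -/
def hermiteFunction (l k : ℕ) (P : CliffordPoly m) (x : EuclideanSpace ℝ (Fin m)) : Cl ℝ m :=
  ((√(hermiteGamma m l k))⁻¹ * Real.exp (-‖x‖ ^ 2 / 4)) • hermitePoly l P x

end Hermite

/-! ### The Segal-Bargmann transform and the Segal-Bargmann module -/

section Bargmann

variable {m : ℕ}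

/-- The Segal-Bargmann transform
`(B f)(z) = (2π) ^ (-m/2) ∫ exp(-z⬝z/2 + x⬝z - x⬝x/4) f(x) dx` with bilinear dot products. -/
def bargmann (f : EuclideanSpace ℝ (Fin m) → Cl ℝ m) (z : Fin m → ℂ) : Cl ℂ m :=
  (√(2 * Real.pi) ^ m)⁻¹ •
    ∫ x : EuclideanSpace ℝ (Fin m),
      Complex.exp (-(∑ j, z j * z j) / 2 + ∑ j, (x j : ℂ) * z j
        - (∑ j, (x j : ℂ) * (x j : ℂ)) / 4) • complexify (f x)

/-- The measure `π ^ (-m) exp(-|z|²) dx dy` on `ℂ ^ m`. -/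
def fockMeasure (m : ℕ) : Measure (Fin m → ℂ) :=
  volume.withDensity fun z =>
    ENNReal.ofReal (Real.exp (-∑ j, ‖z j‖ ^ 2) / Real.pi ^ m)

/-- The function `z ↦ z ^ l P(z)` on `ℂ ^ m`, where the power is that of the Clifford vector. -/
def vecPowMul (l : ℕ) (P : CliffordPoly m) (z : Fin m → ℂ) : Cl ℂ m :=
  vec z ^ l * P.evalComplex z

/-- The Segal-Bargmann module: the closure in `L²(ℂ ^ m, π ^ (-m) exp(-|z|²), Cl)` of the right
module generated by the functions `z ^ l P(z)`, where `l` and `k` are natural numbers and `P` is an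
inner spherical monogenic of order `k`. This right module is the complex linear span of the
functions `z ^ l P(z) a` with `a` in the complex Clifford algebra. -/
def segalBargmannModule (m : ℕ) : Submodule ℂ (Lp (Cl ℂ m) 2 (fockMeasure m)) :=
  (Submodule.span ℂ {F : Lp (Cl ℂ m) 2 (fockMeasure m) |
    ∃ (l k : ℕ) (P : CliffordPoly m) (a : Cl ℂ m), P ∈ monogenics m k ∧
      F =ᵐ[fockMeasure m] fun z => vecPowMul l P z * a}).topologicalClosure

end Bargmann

end SegalBargmann

end

open SegalBargmann

/-
Gaussian integration by parts makes `x_j - ∂_j` adjoint to `∂_j` for the weight `exp(-|x|² / 2)`,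
and multiplication by `z_j` is adjoint to `∂_j` for the Fock inner product. In both pictures the
Clifford vector `X` built from the adjoint operators and the Dirac operator `D` satisfy `X D + D X =
-(2 N + m)`, where the number operator `N` is raised by one under `X`. Hence on a monogenic `P` of
order `k`, where `D P = 0` and, as `P` is harmonic, `N P = k P`, the inner products of the `X ^ l P`
are computed by lowering one step at a time, and come out as the same multiple of the inner product
of the monogenics in both pictures. The transform intertwines `x_j - ∂_j` with multiplication by
`z_j`, so it carries one family to the other. Finally, `L²` is a Hilbert space for the scalar part
of `F† G`, in which the products of an orthonormal family with the blades are orthonormal in the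
usual sense, and the expansion follows from the one in the closed span of these products.
-/

noncomputable section

namespace SegalBargmann

/-! ### The real and complex Clifford algebras -/

section ListProducts

variable {R : Type*} [Ring R]

theorem list_prod_mul_of_anticomm (a : R) (l : List R) (h : ∀ b ∈ l, b * a = -(a * b)) :
    l.prod * a = (-1) ^ l.length * (a * l.prod) := by
  induction l with
  | nil => simp
  | cons b l ih =>
    rw [List.forall_mem_cons] at h
    have hcomm : Commute b ((-1) ^ l.length) := (Commute.neg_one_right b).pow_right _
    rw [List.prod_cons, mul_assoc, ih h.2, hcomm.left_comm, ← mul_assoc b, h.1, List.length_cons,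
      pow_succ]
    simp [mul_assoc]

theorem reverse_map_neg_prod (l : List R) (h : l.Pairwise fun a b => b * a = -(a * b)) :
    (l.map Neg.neg).reverse.prod = (-1) ^ (l.length * (l.length + 1) / 2) * l.prod := by
  induction l with
  | nil => simp
  | cons a l ih =>
    rw [List.pairwise_cons] at h
    have htriangle : (l.length + 1) * (l.length + 1 + 1) / 2 =
        l.length * (l.length + 1) / 2 + l.length + 1 := by
      rw [show (l.length + 1) * (l.length + 1 + 1) =
        l.length * (l.length + 1) + (l.length + 1) * 2 by ring,
        Nat.add_mul_div_right _ _ two_pos, add_assoc]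
    rw [List.map_cons, List.reverse_cons, List.prod_append, ih h.2, List.prod_singleton, mul_assoc,
      mul_neg, list_prod_mul_of_anticomm a l h.1, List.length_cons, List.prod_cons, htriangle,
      pow_succ, pow_add]
    simp [mul_assoc]

theorem reverse_map_neg_prod_mul_prod (l : List R) (h : ∀ a ∈ l, a * a = -1) :
    (l.map Neg.neg).reverse.prod * l.prod = 1 := by
  induction l with
  | nil => simp
  | cons a l ih =>
    rw [List.forall_mem_cons] at h
    rw [List.map_cons, List.reverse_cons, List.prod_append, List.prod_singleton, List.prod_cons,
      mul_assoc, ← mul_assoc (-a), neg_mul, h.1, neg_neg, one_mul, ih h.2]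

theorem star_list_prod [StarRing R] (l : List R) : star l.prod = (l.map star).reverse.prod := by
  induction l with
  | nil => simp
  | cons a l ih => simp [ih]

theorem list_prod_map_smul {𝕜 I : Type*} [CommSemiring 𝕜] [Algebra 𝕜 R] (c : I → 𝕜) (f : I → R)
    (l : List I) : (l.map fun i => c i • f i).prod = (l.map c).prod • (l.map f).prod := by
  induction l with
  | nil => simp
  | cons i l ih =>
    rw [List.map_cons, List.prod_cons, ih, smul_mul_smul_comm, List.map_cons, List.prod_cons,
      List.map_cons, List.prod_cons]

end ListProducts

section Algebra

variable {𝕜 : Type} [RCLike 𝕜] {m : ℕ}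

theorem polar_negSumSq (v w : Fin m → 𝕜) :
    QuadraticMap.polar (negSumSq 𝕜 m) v w = -2 * (v ⬝ᵥ w) := by
  simp only [QuadraticMap.polar, negSumSq, QuadraticMap.weightedSumSquares_apply, Pi.add_apply,
    ← Finset.sum_sub_distrib, smul_eq_mul, dotProduct, Finset.mul_sum]
  exact Finset.sum_congr rfl fun i _ => by ring

theorem gen_mul_gen_add (i j : Fin m) :
    gen 𝕜 i * gen 𝕜 j + gen 𝕜 j * gen 𝕜 i = if i = j then -2 else 0 := by
  refine (CliffordAlgebra.ι_mul_ι_add_swap (Q := negSumSq 𝕜 m) _ _).trans ?_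
  rw [polar_negSumSq, single_dotProduct, one_mul, Pi.single_apply]
  split_ifs with h
  · exact (map_mul (algebraMap 𝕜 (Cl 𝕜 m)) (-2) 1).trans (by simp [map_ofNat])
  · exact (congrArg _ (mul_zero _)).trans (map_zero (algebraMap 𝕜 (Cl 𝕜 m)))

theorem gen_mul_self (j : Fin m) : gen 𝕜 j * gen 𝕜 j = -1 := by
  have h := gen_mul_gen_add (𝕜 := 𝕜) j j
  rw [if_pos rfl, ← two_smul 𝕜, show (-2 : Cl 𝕜 m) = (2 : 𝕜) • (-1 : Cl 𝕜 m) by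
    rw [smul_neg, two_smul, one_add_one_eq_two]] at h
  exact smul_right_injective _ two_ne_zero h

theorem gen_mul_gen_of_ne {i j : Fin m} (h : i ≠ j) :
    gen 𝕜 i * gen 𝕜 j = -(gen 𝕜 j * gen 𝕜 i) :=
  eq_neg_of_add_eq_zero_left ((gen_mul_gen_add i j).trans (if_neg h))

theorem blade_eq_prod_map_sort (A : Finset (Fin m)) :
    blade 𝕜 A = (A.sort.map (gen 𝕜)).prod := by
  refine congrArg List.prod (List.ext_getElem (by simp) fun i _ _ => ?_)
  simp [Finset.orderEmbOfFin_apply]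

theorem blade_empty : blade 𝕜 (∅ : Finset (Fin m)) = 1 := by
  simp [blade]

theorem sum_repr_smul_blade (a : Cl 𝕜 m) : ∑ A, (bladeBasis 𝕜 m).repr a A • blade 𝕜 A = a := by
  simpa only [bladeBasis_apply] using (bladeBasis 𝕜 m).sum_repr a

theorem repr_blade (A : Finset (Fin m)) :
    (bladeBasis 𝕜 m).repr (blade 𝕜 A) = Finsupp.single A 1 := by
  rw [← bladeBasis_apply, Module.Basis.repr_self]

theorem linearMap_ext_blade {σ : 𝕜 →+* 𝕜} {V : Type*} [AddCommMonoid V] [Module 𝕜 V]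
    {f g : Cl 𝕜 m →ₛₗ[σ] V} (h : ∀ A, f (blade 𝕜 A) = g (blade 𝕜 A)) : f = g :=
  (bladeBasis 𝕜 m).ext fun A => by simpa only [bladeBasis_apply] using h A

theorem norm_sq_eq (a : Cl 𝕜 m) : ‖a‖ ^ 2 = ∑ A, ‖(bladeBasis 𝕜 m).repr a A‖ ^ 2 :=
  EuclideanSpace.norm_sq_eq (coeffs 𝕜 m a)

/-- The Clifford conjugation, the antiautomorphism with `eⱼ ↦ -eⱼ`. It is linear over `𝕜`, so that
it is `dagger` over the reals, whereas over the complex numbers it agrees with `dagger` on blades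
only. -/
instance : StarRing (Cl 𝕜 m) := inferInstanceAs (StarRing (CliffordAlgebra (negSumSq 𝕜 m)))

theorem star_smul_cl (c : 𝕜) (a : Cl 𝕜 m) : star (c • a) = c • star a :=
  CliffordAlgebra.star_smul (Q := negSumSq 𝕜 m) c a

theorem star_gen (j : Fin m) : star (gen 𝕜 j) = -gen 𝕜 j :=
  CliffordAlgebra.star_ι (Q := negSumSq 𝕜 m) _

theorem star_blade (A : Finset (Fin m)) :
    star (blade 𝕜 A) = ((A.sort.map (gen 𝕜)).map Neg.neg).reverse.prod := by
  rw [blade_eq_prod_map_sort, star_list_prod, List.map_map, List.map_map]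
  exact congrArg (fun f => (A.sort.map f).reverse.prod) (funext fun j => star_gen (𝕜 := 𝕜) j)

theorem star_blade_eq_smul (A : Finset (Fin m)) :
    star (blade 𝕜 A) = (-1 : 𝕜) ^ (A.card * (A.card + 1) / 2) • blade 𝕜 A := by
  have hanticomm : (A.sort.map (gen 𝕜)).Pairwise fun a b => b * a = -(a * b) :=
    List.pairwise_map.2 ((A.sort_nodup _).imp fun hij => gen_mul_gen_of_ne hij.symm)
  rw [star_blade, reverse_map_neg_prod _ hanticomm, List.length_map, Finset.length_sort,
    ← blade_eq_prod_map_sort, Algebra.smul_def, map_pow, map_neg, map_one]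

theorem star_blade_mul_self (A : Finset (Fin m)) : star (blade 𝕜 A) * blade 𝕜 A = 1 := by
  rw [star_blade, blade_eq_prod_map_sort]
  exact reverse_map_neg_prod_mul_prod _ (List.forall_mem_map.2 fun j _ => gen_mul_self j)

/-- The inclusion of the real into the complex Clifford algebra as an algebra homomorphism. -/
def complexifyHom (m : ℕ) : Cl ℝ m →ₐ[ℝ] Cl ℂ m :=
  CliffordAlgebra.lift (negSumSq ℝ m)
    ⟨(CliffordAlgebra.ι (negSumSq ℂ m)).restrictScalars ℝ ∘ₗ
      (Algebra.linearMap ℝ ℂ).compLeft (Fin m), fun v =>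
      (CliffordAlgebra.ι_sq_scalar (negSumSq ℂ m) _).trans <| by
        rw [IsScalarTower.algebraMap_apply ℝ ℂ (Cl ℂ m)]
        congr 1
        simp [negSumSq, QuadraticMap.weightedSumSquares_apply]⟩

theorem complexifyHom_gen (j : Fin m) : complexifyHom m (gen ℝ j) = gen ℂ j := by
  refine (CliffordAlgebra.lift_ι_apply (Q := negSumSq ℝ m) _ _ _).trans ?_
  refine congrArg (CliffordAlgebra.ι (negSumSq ℂ m)) (funext fun i => ?_)
  simp [Pi.single_apply, apply_ite]

theorem complexifyHom_blade (A : Finset (Fin m)) : complexifyHom m (blade ℝ A) = blade ℂ A := by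
  rw [blade_eq_prod_map_sort, blade_eq_prod_map_sort, map_list_prod, List.map_map]
  exact congrArg (fun f => (A.sort.map f).prod) (funext complexifyHom_gen)

theorem complexify_eq (a : Cl ℝ m) : complexify a = complexifyHom m a := by
  conv_rhs => rw [← sum_repr_smul_blade a, map_sum]
  simp only [map_smul, complexifyHom_blade, complexify, Complex.coe_smul]

theorem repr_complexifyHom (a : Cl ℝ m) (A : Finset (Fin m)) :
    (bladeBasis ℂ m).repr (complexifyHom m a) A = (((bladeBasis ℝ m).repr a A : ℝ) : ℂ) := by
  rw [← complexify_eq, complexify, map_sum, Finsupp.finsetSum_apply]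
  simp only [map_smul, Finsupp.smul_apply, repr_blade, Finsupp.single_apply, smul_eq_mul, mul_ite,
    mul_one, mul_zero, Finset.sum_ite_eq', Finset.mem_univ, if_true]

theorem repr_dagger (a : Cl 𝕜 m) (A : Finset (Fin m)) : (bladeBasis 𝕜 m).repr (dagger a) A =
    starRingEnd 𝕜 ((bladeBasis 𝕜 m).repr a A) * (-1) ^ (A.card * (A.card + 1) / 2) := by
  rw [dagger, map_sum, Finsupp.finsetSum_apply]
  simp [repr_blade, Finsupp.single_apply]

/-- The involution `dagger` as a conjugate-linear map. -/
def daggerₗ (𝕜 : Type) [RCLike 𝕜] (m : ℕ) : Cl 𝕜 m →ₛₗ[starRingEnd 𝕜] Cl 𝕜 m where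
  toFun := dagger
  map_add' a b := by simp [dagger, add_mul, add_smul, Finset.sum_add_distrib]
  map_smul' c a := by simp [dagger, Finset.smul_sum, smul_smul, mul_assoc]

theorem daggerₗ_apply (a : Cl 𝕜 m) : daggerₗ 𝕜 m a = dagger a := rfl

theorem dagger_add (a b : Cl 𝕜 m) : dagger (a + b) = dagger a + dagger b :=
  map_add (daggerₗ 𝕜 m) a b

theorem dagger_smul (c : 𝕜) (a : Cl 𝕜 m) : dagger (c • a) = starRingEnd 𝕜 c • dagger a :=
  map_smulₛₗ (daggerₗ 𝕜 m) c a

theorem dagger_blade (A : Finset (Fin m)) : dagger (blade 𝕜 A) = star (blade 𝕜 A) := by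
  rw [star_blade_eq_smul, dagger, Finset.sum_eq_single A]
  · simp [repr_blade]
  · intro B _ hB
    simp [repr_blade, hB.symm]
  · simp

theorem dagger_real (a : Cl ℝ m) : dagger a = star a := by
  rw [← sum_repr_smul_blade a, ← daggerₗ_apply, map_sum, star_sum]
  refine Finset.sum_congr rfl fun A _ => ?_
  rw [daggerₗ_apply, dagger_smul, dagger_blade, star_smul_cl, conj_trivial]

theorem dagger_gen_real (j : Fin m) : dagger (gen ℝ j) = -gen ℝ j := by
  rw [dagger_real, star_gen]

theorem dagger_mul_real (a b : Cl ℝ m) : dagger (a * b) = dagger b * dagger a := by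
  simp only [dagger_real, star_mul]

theorem dagger_real_smul (c : ℝ) (a : Cl ℂ m) : dagger (c • a) = c • dagger a := by
  rw [← Complex.coe_smul, dagger_smul, Complex.conj_ofReal, Complex.coe_smul]

theorem dagger_complexifyHom (a : Cl ℝ m) :
    dagger (complexifyHom m a) = complexifyHom m (dagger a) := by
  refine (bladeBasis ℂ m).repr.injective (Finsupp.ext fun A => ?_)
  rw [repr_dagger, repr_complexifyHom, repr_complexifyHom, repr_dagger]
  simp

theorem dagger_mul (a b : Cl ℂ m) : dagger (a * b) = dagger b * dagger a := by
  have hblade (A B : Finset (Fin m)) :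
      dagger (blade ℂ A * blade ℂ B) = dagger (blade ℂ B) * dagger (blade ℂ A) := by
    simp only [← complexifyHom_blade, ← map_mul, dagger_complexifyHom, dagger_mul_real]
  rw [← sum_repr_smul_blade a, ← sum_repr_smul_blade b]
  simp only [← daggerₗ_apply, Finset.sum_mul_sum, map_sum, smul_mul_smul_comm, map_smulₛₗ, map_mul]
  simp only [daggerₗ_apply, hblade]
  rw [Finset.sum_comm]
  simp only [mul_comm]

/-! ### The scalar part -/

/-- The reflection automorphism that changes the sign of the generator `eⱼ`. -/
def signFlip (𝕜 : Type) [RCLike 𝕜] {m : ℕ} (j : Fin m) : Cl 𝕜 m →ₐ[𝕜] Cl 𝕜 m :=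
  CliffordAlgebra.map (Q₁ := negSumSq 𝕜 m) (Q₂ := negSumSq 𝕜 m)
    { toLinearMap := LinearMap.mulLeft 𝕜 (Function.update 1 j (-1))
      map_app' := fun v => by
        simp only [negSumSq, QuadraticMap.weightedSumSquares_apply]
        refine Finset.sum_congr rfl fun i _ => ?_
        by_cases h : i = j <;> simp [h] }

theorem signFlip_gen (j i : Fin m) :
    signFlip 𝕜 j (gen 𝕜 i) = (Function.update 1 j (-1) : Fin m → 𝕜) i • gen 𝕜 i := by
  refine (CliffordAlgebra.map_apply_ι (Q₁ := negSumSq 𝕜 m) (Q₂ := negSumSq 𝕜 m) _ _).trans ?_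
  refine Eq.trans (congrArg _ ?_) (map_smul (CliffordAlgebra.ι (negSumSq 𝕜 m)) _ _)
  change Function.update (1 : Fin m → 𝕜) j (-1) * Pi.single i 1 = _
  rw [← Pi.single_mul_right, mul_one, ← Pi.single_smul', smul_eq_mul, mul_one]

theorem signFlip_blade (j : Fin m) (A : Finset (Fin m)) :
    signFlip 𝕜 j (blade 𝕜 A) = (if j ∈ A then -1 else 1 : 𝕜) • blade 𝕜 A := by
  have hsign : (A.sort.map (Function.update (1 : Fin m → 𝕜) j (-1))).prod =
      if j ∈ A then -1 else 1 := by
    rw [← List.prod_toFinset _ (A.sort_nodup _), Finset.sort_toFinset]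
    split_ifs with h
    · simp [Finset.prod_update_of_mem h]
    · simp [Finset.prod_update_of_notMem h]
  rw [blade_eq_prod_map_sort, map_list_prod, List.map_map, ← hsign, ← list_prod_map_smul]
  exact congrArg (fun f => (A.sort.map f).prod) (funext fun i => signFlip_gen (𝕜 := 𝕜) j i)

/-- The coefficient of the unit. -/
def scalarPart (𝕜 : Type) [RCLike 𝕜] (m : ℕ) : Cl 𝕜 m →ₗ[𝕜] 𝕜 :=
  (bladeBasis 𝕜 m).coord ∅

theorem scalarPart_blade (A : Finset (Fin m)) :
    scalarPart 𝕜 m (blade 𝕜 A) = if A = ∅ then 1 else 0 := by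
  rw [scalarPart, Module.Basis.coord_apply, repr_blade, Finsupp.single_apply]

theorem scalarPart_signFlip (j : Fin m) (a : Cl 𝕜 m) :
    scalarPart 𝕜 m (signFlip 𝕜 j a) = scalarPart 𝕜 m a := by
  suffices scalarPart 𝕜 m ∘ₗ (signFlip 𝕜 j).toLinearMap = scalarPart 𝕜 m from
    LinearMap.congr_fun this a
  refine linearMap_ext_blade fun A => ?_
  simp only [LinearMap.comp_apply, AlgHom.toLinearMap_apply, signFlip_blade, map_smul,
    scalarPart_blade]
  by_cases hA : A = ∅ <;> simp [hA]

theorem scalarPart_blade_mul_blade_of_ne {A B : Finset (Fin m)} (h : A ≠ B) :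
    scalarPart 𝕜 m (blade 𝕜 A * blade 𝕜 B) = 0 := by
  obtain ⟨j, hj⟩ : ∃ j, ¬(j ∈ A ↔ j ∈ B) := by
    by_contra! hAB
    exact h (Finset.ext hAB)
  -- The reflection in `eⱼ` negates `e_A e_B`, but preserves the scalar part.
  have hflip := scalarPart_signFlip j (blade 𝕜 A * blade 𝕜 B)
  rw [map_mul, signFlip_blade, signFlip_blade, smul_mul_smul_comm, map_smul] at hflip
  refine self_eq_neg.1 ?_
  by_cases hA : j ∈ A <;> by_cases hB : j ∈ B <;> simp_all

theorem scalarPart_dagger_blade_mul (A : Finset (Fin m)) (b : Cl 𝕜 m) :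
    scalarPart 𝕜 m (dagger (blade 𝕜 A) * b) = (bladeBasis 𝕜 m).repr b A := by
  suffices scalarPart 𝕜 m ∘ₗ LinearMap.mulLeft 𝕜 (dagger (blade 𝕜 A)) =
      (bladeBasis 𝕜 m).coord A from LinearMap.congr_fun this b
  refine linearMap_ext_blade fun B => ?_
  obtain rfl | hAB := eq_or_ne A B
  · simp [dagger_blade, star_blade_mul_self, repr_blade, ← blade_empty, scalarPart_blade]
  · simp [dagger_blade, star_blade_eq_smul, scalarPart_blade_mul_blade_of_ne hAB, repr_blade,
      hAB.symm]

theorem scalarPart_dagger_mul (a b : Cl 𝕜 m) :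
    scalarPart 𝕜 m (dagger a * b) =
      ∑ A, starRingEnd 𝕜 ((bladeBasis 𝕜 m).repr a A) * (bladeBasis 𝕜 m).repr b A := by
  conv_lhs => rw [← sum_repr_smul_blade a]
  simp only [← daggerₗ_apply, map_sum, Finset.sum_mul, map_smulₛₗ, smul_mul_assoc]
  simp only [daggerₗ_apply, scalarPart_dagger_blade_mul, smul_eq_mul, RingHom.id_apply]

end Algebra

/-! ### Ladders -/

section Ladder

variable {R E F : Type*} [CommRing R] [AddCommGroup E] [Module R E] [AddCommGroup F] [Module R F]
  {D X N : Module.End R E} {c κ : R} {u v : E} {B : E →ₗ[R] E →ₗ[R] F}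

/-- A lowering operator `D`, a raising operator `X` and a number operator `N` with
`D X + X D = -(2 N + c)` and `[N, X] = X`: for the Dirac operator, the multiplication by the vector
variable and the Euler operator in dimension `c` these are the relations of `osp(1|2)`. -/
structure IsLadder (D X N : Module.End R E) (c : R) : Prop where
  anticomm : D * X + X * D = -((2 : R) • N + c • 1)
  comm : N * X = X * N + X

/-- A vector of weight `κ` at the bottom of a ladder. -/
structure IsLowestWeight (D N : Module.End R E) (κ : R) (u : E) : Prop where
  lowering_eq : D u = 0
  number_eq : N u = κ • u

/-- The factor by which the lowering operator acts on the `l`-th step of the ladder over a vector of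
weight `κ`. -/
def lowerCoeff (c κ : R) (l : ℕ) : R := if Even l then l else c + 2 * κ + l - 1

/-- The product of the first `l` lowering factors. -/
def lowerProd (c κ : R) (l : ℕ) : R := ∏ i ∈ Finset.range l, lowerCoeff c κ (i + 1)

/-- A form for which the raising operator is minus the adjoint of the lowering operator. -/
structure IsLadderForm (D X : Module.End R E) (B : E →ₗ[R] E →ₗ[R] F) : Prop where
  raising_left : ∀ u v, B (X u) v = -B u (D v)
  lowering_left : ∀ u v, B (D u) v = -B u (X v)

theorem lowerCoeff_succ (c κ : R) (l : ℕ) :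
    lowerCoeff c κ (l + 1) = c + 2 * (l + κ) - lowerCoeff c κ l := by
  by_cases h : Even l
  · simp only [lowerCoeff, h, Nat.even_add_one, not_true_eq_false, if_true, if_false]
    push_cast
    ring
  · simp only [lowerCoeff, h, Nat.even_add_one, not_false_eq_true, if_true, if_false]
    push_cast
    ring

theorem IsLadder.lowering_raising (h : IsLadder D X N c) (u : E) :
    D (X u) = -X (D u) - (2 : R) • N u - c • u := by
  have := LinearMap.congr_fun h.anticomm u
  simp only [LinearMap.add_apply, LinearMap.neg_apply, Module.End.mul_apply,
    LinearMap.smul_apply, Module.End.one_apply] at this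
  rw [eq_sub_of_add_eq this]
  abel

theorem IsLadder.number_raising_pow (h : IsLadder D X N c) (hu : IsLowestWeight D N κ u) (l : ℕ) :
    N ((X ^ l) u) = (l + κ) • (X ^ l) u := by
  induction l with
  | zero => simpa using hu.number_eq
  | succ l ih =>
    have := LinearMap.congr_fun h.comm ((X ^ l) u)
    simp only [LinearMap.add_apply, Module.End.mul_apply] at this
    rw [pow_succ', Module.End.mul_apply, this, ih, map_smul]
    push_cast
    module

theorem IsLadder.lowering_raising_pow (h : IsLadder D X N c) (hu : IsLowestWeight D N κ u)
    (l : ℕ) : D ((X ^ (l + 1)) u) = -lowerCoeff c κ (l + 1) • (X ^ l) u := by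
  rw [pow_succ', Module.End.mul_apply, h.lowering_raising, h.number_raising_pow hu,
    lowerCoeff_succ]
  cases l with
  | zero =>
    simp only [pow_zero, Module.End.one_apply, hu.lowering_eq, map_zero, lowerCoeff, Nat.cast_zero,
      Even.zero, if_true]
    module
  | succ l =>
    rw [IsLadder.lowering_raising_pow h hu l, map_smul, ← Module.End.mul_apply, ← pow_succ']
    module

theorem IsLadder.form_raising_pow (h : IsLadder D X N c) (hB : IsLadderForm D X B)
    (hu : D u = 0) (hv : IsLowestWeight D N κ v) (l l' : ℕ) :
    B ((X ^ l) u) ((X ^ l') v) = if l = l' then lowerProd c κ l • B u v else 0 := by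
  induction l generalizing l' with
  | zero =>
    cases l' with
    | zero => simp [lowerProd]
    | succ l' =>
      have hzero := hB.lowering_left u ((X ^ l') v)
      rw [hu, map_zero, LinearMap.zero_apply, zero_eq_neg] at hzero
      rw [pow_zero, Module.End.one_apply, pow_succ', Module.End.mul_apply, hzero, if_neg (by simp)]
  | succ l ih =>
    rw [pow_succ', Module.End.mul_apply, hB.raising_left]
    cases l' with
    | zero => simp [hv.lowering_eq]
    | succ l' =>
      rw [h.lowering_raising_pow hv, map_smul, ih]
      by_cases hl : l = l'
      · subst hl
        simp [lowerProd, Finset.prod_range_succ, smul_smul, mul_comm]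
      · simp [hl]

end Ladder

theorem IsLadder.form_eq_zero_of_weight_ne {K E F : Type*} [Field K] [NeZero (2 : K)]
    [AddCommGroup E] [Module K E] [AddCommGroup F] [Module K F] {D X N : Module.End K E}
    {c κ κ' : K} {u v : E} {B : E →ₗ[K] E →ₗ[K] F} (h : IsLadder D X N c)
    (hB : IsLadderForm D X B) (hu : IsLowestWeight D N κ u) (hv : IsLowestWeight D N κ' v)
    (hκ : κ ≠ κ') : B u v = 0 := by
  -- The anticommutator, and hence the number operator, is self-adjoint.
  have hself : B ((D * X + X * D) u) v = B u ((D * X + X * D) v) := by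
    simp [hB.raising_left, hB.lowering_left]
  have hweight : (2 * (κ - κ')) • B u v = 0 := by
    simp only [h.anticomm, LinearMap.neg_apply, LinearMap.add_apply, LinearMap.smul_apply,
      Module.End.one_apply, hu.number_eq, hv.number_eq, map_neg, map_add, map_smul] at hself
    linear_combination (norm := module) -hself
  exact (smul_eq_zero.1 hweight).resolve_left (mul_ne_zero two_ne_zero (sub_ne_zero.2 hκ))

/-! ### Operators on tensor products with the Clifford algebra -/

section TensorOperators

open scoped TensorProduct

variable {m : ℕ} {V : Type*} [AddCommGroup V] [Module ℝ V]

/-- The operator `p ⊗ b ↦ L p ⊗ a b` on Clifford algebra-valued vectors. -/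
def tensorOp : Module.End ℝ V →ₗ[ℝ] Cl ℝ m →ₗ[ℝ] Module.End ℝ (V ⊗[ℝ] Cl ℝ m) :=
  (TensorProduct.mapBilinear (RingHom.id ℝ) V (Cl ℝ m) V (Cl ℝ m)).compl₂
    (LinearMap.mul ℝ (Cl ℝ m))

theorem tensorOp_tmul (L : Module.End ℝ V) (a : Cl ℝ m) (p : V) (b : Cl ℝ m) :
    tensorOp L a (p ⊗ₜ b) = L p ⊗ₜ (a * b) := rfl

theorem tensorOp_mul_tensorOp (L L' : Module.End ℝ V) (a b : Cl ℝ m) :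
    tensorOp L a * tensorOp L' b = tensorOp (L * L') (a * b) :=
  TensorProduct.ext' fun p c => by
    simp only [Module.End.mul_apply, tensorOp_tmul, mul_assoc]

/-- The action of a scalar operator on Clifford algebra-valued vectors. -/
def scalarOp (L : Module.End ℝ V) : Module.End ℝ (V ⊗[ℝ] Cl ℝ m) := tensorOp L 1

/-- The operator `∑ eⱼ Lⱼ`, for example the Dirac operator if the `Lⱼ` are the partial
derivatives. -/
def cliffOp (L : Fin m → Module.End ℝ V) : Module.End ℝ (V ⊗[ℝ] Cl ℝ m) :=
  ∑ j, tensorOp (L j) (gen ℝ j)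

theorem scalarOp_tmul (L : Module.End ℝ V) (p : V) (a : Cl ℝ m) :
    scalarOp L (p ⊗ₜ a) = L p ⊗ₜ a := by
  rw [scalarOp, tensorOp_tmul, one_mul]

theorem cliffOp_tmul (L : Fin m → Module.End ℝ V) (p : V) (a : Cl ℝ m) :
    cliffOp L (p ⊗ₜ a) = ∑ j, L j p ⊗ₜ (gen ℝ j * a) := by
  simp only [cliffOp, LinearMap.sum_apply, tensorOp_tmul]

theorem scalarOp_one : scalarOp (1 : Module.End ℝ V) = (1 : Module.End ℝ (V ⊗[ℝ] Cl ℝ m)) :=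
  TensorProduct.ext' fun p a => scalarOp_tmul 1 p a

theorem cliffOp_mul_add_cliffOp_mul {L L' : Fin m → Module.End ℝ V} {c : ℝ}
    (h : ∀ i j, L i * L' j = L' j * L i + if i = j then c • 1 else 0) :
    cliffOp L * cliffOp L' + cliffOp L' * cliffOp L =
      -((2 : ℝ) • scalarOp (∑ j, L' j * L j) + (m * c) • 1) := by
  have hswap (i j : Fin m) : tensorOp (L i * L' j) (gen ℝ i * gen ℝ j) +
      tensorOp (L' j * L i) (gen ℝ j * gen ℝ i) =
        if i = j then -((2 : ℝ) • scalarOp (L' i * L i) + c • 1) else 0 := by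
    rw [h, map_add, LinearMap.add_apply, add_right_comm, ← map_add, gen_mul_gen_add]
    split_ifs with hij
    · subst hij
      have htwo : (-2 : Cl ℝ m) = (2 : ℝ) • (-1 : Cl ℝ m) := by
        rw [smul_neg, two_smul, one_add_one_eq_two]
      rw [gen_mul_self, htwo, map_smul, map_smul, LinearMap.smul_apply, map_neg, map_neg,
        ← scalarOp_one, scalarOp, scalarOp]
      module
    · simp only [map_zero, LinearMap.zero_apply, add_zero]
  simp only [cliffOp, Finset.sum_mul_sum, tensorOp_mul_tensorOp]
  rw [Finset.sum_comm (f := fun i j => tensorOp (L' i * L j) _), ← Finset.sum_add_distrib]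
  simp only [← Finset.sum_add_distrib, hswap, Finset.sum_ite_eq, Finset.mem_univ, if_true]
  simp only [scalarOp, map_sum, LinearMap.sum_apply, Finset.sum_neg_distrib,
    Finset.sum_add_distrib, Finset.smul_sum, Finset.sum_const, Finset.card_univ, Fintype.card_fin,
    ← Nat.cast_smul_eq_nsmul ℝ, smul_smul]

/-- The canonical commutation relations `[Dᵢ, Tⱼ] = δᵢⱼ` with commuting `Tⱼ`. -/
structure IsCanonicalPair (D T : Fin m → Module.End ℝ V) : Prop where
  comm : ∀ i j, T i * T j = T j * T i
  lowering_mul : ∀ i j, D i * T j = T j * D i + if i = j then 1 else 0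

/-- The number operator `∑ Tⱼ Dⱼ`. -/
def numberOp (D T : Fin m → Module.End ℝ V) : Module.End ℝ V := ∑ j, T j * D j

variable {D T : Fin m → Module.End ℝ V}

theorem IsCanonicalPair.numberOp_mul (h : IsCanonicalPair D T) (j : Fin m) :
    numberOp D T * T j = T j * numberOp D T + T j := by
  have hterm (i : Fin m) : T i * D i * T j = T j * (T i * D i) + if i = j then T i else 0 := by
    rw [mul_assoc, h.lowering_mul, mul_add, ← mul_assoc, h.comm, mul_assoc, mul_ite, mul_one,
      mul_zero]
  simp only [numberOp, Finset.sum_mul, Finset.mul_sum, hterm, Finset.sum_add_distrib,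
    Finset.sum_ite_eq', Finset.mem_univ, if_true]

theorem IsCanonicalPair.isLadder (h : IsCanonicalPair D T) :
    IsLadder (cliffOp D) (cliffOp T) (scalarOp (numberOp D T)) (m : ℝ) where
  anticomm := by
    rw [cliffOp_mul_add_cliffOp_mul (c := 1) (by simpa only [one_smul] using h.lowering_mul),
      mul_one, numberOp]
  comm := by
    simp only [scalarOp, cliffOp, Finset.mul_sum, Finset.sum_mul, tensorOp_mul_tensorOp, one_mul,
      mul_one, h.numberOp_mul, map_add, LinearMap.add_apply, Finset.sum_add_distrib]

theorem cliffOp_mul_self (h : ∀ i j, D i * D j = D j * D i) :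
    cliffOp D * cliffOp D = -scalarOp (∑ j, D j * D j) := by
  have hanti := cliffOp_mul_add_cliffOp_mul (L := D) (L' := D) (c := 0) fun i j => by
    rw [zero_smul, ite_self, add_zero, h]
  rw [mul_zero, zero_smul, add_zero, ← two_smul ℝ] at hanti
  exact smul_right_injective _ (two_ne_zero (α := ℝ)) (hanti.trans (smul_neg _ _).symm)

/-! ### Clifford algebra-valued pairings -/

/-- The Clifford algebra-valued extension `(p ⊗ a, q ⊗ b) ↦ B(p, q) a† b` of a bilinear form. -/
def pairing (B : V →ₗ[ℝ] V →ₗ[ℝ] ℝ) :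
    V ⊗[ℝ] Cl ℝ m →ₗ[ℝ] V ⊗[ℝ] Cl ℝ m →ₗ[ℝ] Cl ℝ m :=
  (TensorProduct.map₂ B ((LinearMap.mul ℝ (Cl ℝ m)).comp (daggerₗ ℝ m))).compr₂
    (TensorProduct.lid ℝ (Cl ℝ m)).toLinearMap

theorem pairing_tmul (B : V →ₗ[ℝ] V →ₗ[ℝ] ℝ) (p q : V) (a b : Cl ℝ m) :
    pairing B (p ⊗ₜ a) (q ⊗ₜ b) = B p q • (dagger a * b) := rfl

theorem pairing_cliffOp_left {B : V →ₗ[ℝ] V →ₗ[ℝ] ℝ} {L L' : Fin m → Module.End ℝ V}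
    (h : ∀ j p q, B (L j p) q = B p (L' j q)) (u v : V ⊗[ℝ] Cl ℝ m) :
    pairing B (cliffOp L u) v = -pairing B u (cliffOp L' v) := by
  suffices (pairing B).comp (cliffOp L) = -(pairing B).compl₂ (cliffOp L') from
    LinearMap.congr_fun₂ this u v
  refine TensorProduct.ext' fun p a => TensorProduct.ext' fun q b => ?_
  simp only [LinearMap.comp_apply, LinearMap.neg_apply, LinearMap.compl₂_apply, cliffOp_tmul,
    map_sum, LinearMap.sum_apply, pairing_tmul, h, dagger_mul_real, dagger_gen_real, mul_neg,
    neg_mul, smul_neg, Finset.sum_neg_distrib, mul_assoc]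

/-- A symmetric bilinear form for which the operators `Tⱼ` are adjoint to the `Dⱼ`. -/
structure IsAdjointForm (D T : Fin m → Module.End ℝ V) (B : V →ₗ[ℝ] V →ₗ[ℝ] ℝ) : Prop where
  symm : ∀ p q, B p q = B q p
  adjoint : ∀ j p q, B (T j p) q = B p (D j q)

theorem IsAdjointForm.isLadderForm {B : V →ₗ[ℝ] V →ₗ[ℝ] ℝ} (h : IsAdjointForm D T B) :
    IsLadderForm (cliffOp D) (cliffOp T) (pairing B) where
  raising_left := pairing_cliffOp_left h.adjoint
  lowering_left := pairing_cliffOp_left fun j p q => by rw [h.symm, ← h.adjoint, h.symm]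

/-! ### Components and linear extensions -/

/-- The component of a Clifford algebra-valued vector with respect to a blade. -/
def component (A : Finset (Fin m)) : V ⊗[ℝ] Cl ℝ m →ₗ[ℝ] V :=
  (TensorProduct.rid ℝ V).toLinearMap ∘ₗ LinearMap.lTensor V ((bladeBasis ℝ m).coord A)

theorem component_tmul (A : Finset (Fin m)) (p : V) (a : Cl ℝ m) :
    component A (p ⊗ₜ a) = (bladeBasis ℝ m).repr a A • p := rfl

theorem sum_component (u : V ⊗[ℝ] Cl ℝ m) : ∑ A, component A u ⊗ₜ blade ℝ A = u := by
  induction u using TensorProduct.induction_on with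
  | zero => simp only [map_zero, TensorProduct.zero_tmul, Finset.sum_const_zero]
  | tmul p a => simp only [component_tmul, TensorProduct.smul_tmul, ← TensorProduct.tmul_sum,
      sum_repr_smul_blade]
  | add u v hu hv => simp only [map_add, TensorProduct.add_tmul, Finset.sum_add_distrib, hu, hv]

theorem component_ext {u v : V ⊗[ℝ] Cl ℝ m} (h : ∀ A, component A u = component A v) :
    u = v := by
  rw [← sum_component u, ← sum_component v]
  simp only [h]

theorem component_scalarOp (A : Finset (Fin m)) (L : Module.End ℝ V) (u : V ⊗[ℝ] Cl ℝ m) :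
    component A (scalarOp L u) = L (component A u) := by
  suffices component A ∘ₗ scalarOp L = L ∘ₗ component A from LinearMap.congr_fun this u
  refine TensorProduct.ext' fun p a => ?_
  simp only [LinearMap.comp_apply, scalarOp_tmul, component_tmul, map_smul]

theorem pairing_congr {B B' : V →ₗ[ℝ] V →ₗ[ℝ] ℝ} {u v : V ⊗[ℝ] Cl ℝ m}
    (h : ∀ A A', B (component A u) (component A' v) = B' (component A u) (component A' v)) :
    pairing B u v = pairing B' u v := by
  rw [← sum_component u, ← sum_component v]
  simp only [map_sum, LinearMap.sum_apply, pairing_tmul, h]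

/-- Right multiplication of Clifford algebra-valued vectors by a constant. -/
def mulRightOp (a : Cl ℝ m) : Module.End ℝ (V ⊗[ℝ] Cl ℝ m) :=
  LinearMap.lTensor V (LinearMap.mulRight ℝ a)

theorem mulRightOp_tmul (a : Cl ℝ m) (p : V) (b : Cl ℝ m) :
    mulRightOp a (p ⊗ₜ b) = p ⊗ₜ (b * a) := rfl

variable {K A : Type*} [CommRing K] [Algebra ℝ K] [Ring A] [Algebra ℝ A] [Algebra K A]
  [IsScalarTower ℝ K A]

/-- The Clifford algebra-valued extension `p ⊗ a ↦ S(p) φ(a)` of a scalar functional. -/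
def cliffordExtension (φ : Cl ℝ m →ₐ[ℝ] A) (S : V →ₗ[ℝ] K) : V ⊗[ℝ] Cl ℝ m →ₗ[ℝ] A :=
  TensorProduct.lift (((Algebra.lsmul ℝ ℝ A).toLinearMap ∘ₗ S).compl₂ φ.toLinearMap)

theorem cliffordExtension_tmul (φ : Cl ℝ m →ₐ[ℝ] A) (S : V →ₗ[ℝ] K) (p : V) (a : Cl ℝ m) :
    cliffordExtension φ S (p ⊗ₜ a) = S p • φ a := rfl

theorem cliffordExtension_eq_sum (φ : Cl ℝ m →ₐ[ℝ] A) (S : V →ₗ[ℝ] K) (u : V ⊗[ℝ] Cl ℝ m) :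
    cliffordExtension φ S u = ∑ A, S (component A u) • φ (blade ℝ A) := by
  conv_lhs => rw [← sum_component u]
  simp only [map_sum, cliffordExtension_tmul]

theorem cliffordExtension_cliffOp (φ : Cl ℝ m →ₐ[ℝ] A) (S : V →ₗ[ℝ] K)
    (L : Fin m → Module.End ℝ V) (u : V ⊗[ℝ] Cl ℝ m) :
    cliffordExtension φ S (cliffOp L u) =
      ∑ j, φ (gen ℝ j) * cliffordExtension φ (S ∘ₗ L j) u := by
  suffices cliffordExtension φ S ∘ₗ cliffOp L =
      ∑ j, LinearMap.mulLeft ℝ (φ (gen ℝ j)) ∘ₗ cliffordExtension φ (S ∘ₗ L j) by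
    simpa only [LinearMap.sum_apply, LinearMap.comp_apply, LinearMap.mulLeft_apply] using
      LinearMap.congr_fun this u
  refine TensorProduct.ext' fun p a => ?_
  simp only [LinearMap.comp_apply, cliffOp_tmul, map_sum, LinearMap.sum_apply,
    cliffordExtension_tmul, LinearMap.mulLeft_apply, map_mul, mul_smul_comm]

theorem cliffordExtension_mulRightOp (φ : Cl ℝ m →ₐ[ℝ] A) (S : V →ₗ[ℝ] K) (a : Cl ℝ m)
    (u : V ⊗[ℝ] Cl ℝ m) :
    cliffordExtension φ S (mulRightOp a u) = cliffordExtension φ S u * φ a := by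
  suffices cliffordExtension φ S ∘ₗ mulRightOp a =
      LinearMap.mulRight ℝ (φ a) ∘ₗ cliffordExtension φ S from LinearMap.congr_fun this u
  refine TensorProduct.ext' fun p b => ?_
  simp only [LinearMap.comp_apply, mulRightOp_tmul, cliffordExtension_tmul,
    LinearMap.mulRight_apply, map_mul, smul_mul_assoc]

/-- The real Clifford algebra-valued extension of a real functional. -/
abbrev applyReal (S : V →ₗ[ℝ] ℝ) : V ⊗[ℝ] Cl ℝ m →ₗ[ℝ] Cl ℝ m :=
  cliffordExtension (AlgHom.id ℝ (Cl ℝ m)) S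

/-- The complex Clifford algebra-valued extension of a complex functional. -/
abbrev applyComplex (S : V →ₗ[ℝ] ℂ) : V ⊗[ℝ] Cl ℝ m →ₗ[ℝ] Cl ℂ m :=
  cliffordExtension (complexifyHom m) S

theorem repr_applyReal (S : V →ₗ[ℝ] ℝ) (u : V ⊗[ℝ] Cl ℝ m) (A : Finset (Fin m)) :
    (bladeBasis ℝ m).repr (applyReal S u) A = S (component A u) := by
  rw [cliffordExtension_eq_sum, map_sum, Finsupp.finsetSum_apply]
  simp only [AlgHom.id_apply, map_smul, Finsupp.smul_apply, repr_blade, Finsupp.single_apply,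
    smul_eq_mul, mul_ite, mul_one, mul_zero, Finset.sum_ite_eq', Finset.mem_univ, if_true]

theorem applyComplex_cliffOp_pow {S : V →ₗ[ℝ] ℂ} {z : Fin m → ℂ}
    (h : ∀ j p, S (T j p) = z j * S p) (l : ℕ) (u : V ⊗[ℝ] Cl ℝ m) :
    applyComplex S ((cliffOp T ^ l) u) = vec z ^ l * applyComplex S u := by
  have hsmul (j : Fin m) (v : V ⊗[ℝ] Cl ℝ m) :
      applyComplex (S ∘ₗ T j) v = z j • applyComplex S v := by
    simp only [cliffordExtension_eq_sum, LinearMap.comp_apply, h, mul_smul, Finset.smul_sum]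
  induction l with
  | zero => simp only [pow_zero, Module.End.one_apply, one_mul]
  | succ l ih =>
    rw [pow_succ', Module.End.mul_apply, cliffordExtension_cliffOp, pow_succ', mul_assoc, vec,
      Finset.sum_mul]
    simp only [hsmul, ih, complexifyHom_gen, mul_smul_comm, smul_mul_assoc, vec]

end TensorOperators

/-! ### Harmonic polynomials -/

section Polynomials

theorem pderiv_comm {R σ : Type*} [CommRing R] (i j : σ) (p : MvPolynomial σ R) :
    MvPolynomial.pderiv i (MvPolynomial.pderiv j p) =
      MvPolynomial.pderiv j (MvPolynomial.pderiv i p) := by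
  classical
  have hcomm : ⁅MvPolynomial.pderiv (R := R) i, MvPolynomial.pderiv (R := R) j⁆ = 0 := by
    refine MvPolynomial.derivation_ext fun k => ?_
    simp only [Derivation.commutator_apply, MvPolynomial.pderiv_X, Pi.single_apply, apply_ite,
      map_zero, Derivation.map_one_eq_zero, ite_self, sub_self, Derivation.zero_apply]
  have := DFunLike.congr_fun hcomm p
  rwa [Derivation.commutator_apply, Derivation.zero_apply, sub_eq_zero] at this

open scoped TensorProduct

variable {m : ℕ}

/-- The real polynomials in `m` variables. -/
abbrev ScalarPoly (m : ℕ) : Type := MvPolynomial (Fin m) ℝ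

/-- The Clifford polynomials as a tensor product; unlike for `CliffordPoly`, no basis of the
Clifford algebra is involved. -/
abbrev TensorPoly (m : ℕ) : Type := ScalarPoly m ⊗[ℝ] Cl ℝ m

/-- The partial derivative as a linear operator. -/
def partialOp (j : Fin m) : Module.End ℝ (ScalarPoly m) := (MvPolynomial.pderiv j).toLinearMap

/-- The multiplication by a variable as a linear operator. -/
def varOp (j : Fin m) : Module.End ℝ (ScalarPoly m) := LinearMap.mulLeft ℝ (MvPolynomial.X j)

/-- The operator `xⱼ - ∂ⱼ`, which is the adjoint of `∂ⱼ` for the weight `exp(-|x|² / 2)`. -/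
def gaussOp (j : Fin m) : Module.End ℝ (ScalarPoly m) := varOp j - partialOp j

theorem partialOp_apply (j : Fin m) (p : ScalarPoly m) :
    partialOp j p = MvPolynomial.pderiv j p := rfl

theorem varOp_apply (j : Fin m) (p : ScalarPoly m) : varOp j p = MvPolynomial.X j * p := rfl

theorem gaussOp_apply (j : Fin m) (p : ScalarPoly m) :
    gaussOp j p = MvPolynomial.X j * p - MvPolynomial.pderiv j p := rfl

theorem partialOp_mul_comm (i j : Fin m) :
    (partialOp i * partialOp j : Module.End ℝ (ScalarPoly m)) = partialOp j * partialOp i :=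
  LinearMap.ext fun p => pderiv_comm i j p

theorem isCanonicalPair_varOp : IsCanonicalPair (partialOp (m := m)) varOp where
  comm i j := LinearMap.ext fun p => mul_left_comm (MvPolynomial.X i) (MvPolynomial.X j) p
  lowering_mul i j := by
    refine LinearMap.ext fun p => ?_
    rw [Module.End.mul_apply, partialOp_apply, varOp_apply, Derivation.leibniz,
      MvPolynomial.pderiv_X, smul_eq_mul, smul_eq_mul, LinearMap.add_apply]
    by_cases hij : i = j
    · subst hij
      rw [Pi.single_eq_same, mul_one, if_pos rfl]
      rfl
    · rw [Pi.single_eq_of_ne (Ne.symm hij), mul_zero, if_neg hij]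
      rfl

theorem isCanonicalPair_gaussOp : IsCanonicalPair (partialOp (m := m)) gaussOp where
  comm i j := by
    simp only [gaussOp, mul_sub, sub_mul, isCanonicalPair_varOp.comm i j,
      isCanonicalPair_varOp.lowering_mul, partialOp_mul_comm i j, eq_comm (a := j) (b := i)]
    abel
  lowering_mul i j := by
    simp only [gaussOp, mul_sub, sub_mul, isCanonicalPair_varOp.lowering_mul,
      partialOp_mul_comm i j]
    abel

/-- The harmonic homogeneous polynomials of degree `k`. -/
structure IsHarmonic (k : ℕ) (p : ScalarPoly m) : Prop where
  homogeneous : p.IsHomogeneous k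
  laplace : ∑ j, partialOp j (partialOp j p) = 0

theorem IsHarmonic.map_partialOp {k : ℕ} {p : ScalarPoly m} (hp : IsHarmonic (k + 1) p)
    (i : Fin m) : IsHarmonic k (partialOp i p) where
  homogeneous := hp.homogeneous.pderiv
  laplace := by
    simp only [partialOp_apply, pderiv_comm _ i]
    simpa only [partialOp_apply, map_sum, map_zero] using
      congrArg (MvPolynomial.pderiv i) hp.laplace

theorem IsHarmonic.eq_smul_one {p : ScalarPoly m} (hp : IsHarmonic 0 p) :
    ∃ c : ℝ, p = c • 1 :=
  ⟨_, by
    rw [MvPolynomial.smul_eq_C_mul, mul_one]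
    exact MvPolynomial.totalDegree_eq_zero_iff_eq_C.1
      (Nat.le_zero.1 hp.homogeneous.totalDegree_le)⟩

theorem IsHarmonic.numberOp_varOp {k : ℕ} {p : ScalarPoly m} (hp : IsHarmonic k p) :
    numberOp partialOp varOp p = (k : ℝ) • p := by
  simp only [numberOp, LinearMap.sum_apply, Module.End.mul_apply, varOp_apply, partialOp_apply]
  rw [hp.homogeneous.sum_X_mul_pderiv, Nat.cast_smul_eq_nsmul]

theorem IsHarmonic.numberOp_gaussOp {k : ℕ} {p : ScalarPoly m} (hp : IsHarmonic k p) :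
    numberOp partialOp gaussOp p = (k : ℝ) • p := by
  rw [← hp.numberOp_varOp]
  simp only [numberOp, gaussOp, sub_mul, Finset.sum_sub_distrib, LinearMap.sub_apply,
    sub_eq_self, LinearMap.sum_apply, Module.End.mul_apply, hp.laplace]

theorem eq_of_natCast_succ_smul_eq {E : Type*} [AddCommGroup E] [Module ℝ E] {k : ℕ} {a b : E}
    (h : ((k + 1 : ℕ) : ℝ) • a = ((k + 1 : ℕ) : ℝ) • b) : a = b :=
  smul_right_injective E (Nat.cast_ne_zero.2 k.succ_ne_zero) h

-- On harmonic polynomials the Euler operator coincides with both number operators, so `k B(p, q)`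
-- reduces to the values of the form on the derivatives of `p` and `q`.
theorem IsHarmonic.form_eq {B B' : ScalarPoly m →ₗ[ℝ] ScalarPoly m →ₗ[ℝ] ℝ}
    (hB : IsAdjointForm partialOp varOp B) (hB' : IsAdjointForm partialOp gaussOp B')
    (hone : B 1 1 = B' 1 1) {k : ℕ} {p q : ScalarPoly m} (hp : IsHarmonic k p)
    (hq : IsHarmonic k q) : B p q = B' p q := by
  induction k generalizing p q with
  | zero =>
    obtain ⟨c, rfl⟩ := hp.eq_smul_one
    obtain ⟨c', rfl⟩ := hq.eq_smul_one
    simp only [map_smul, LinearMap.smul_apply, hone]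
  | succ k ih =>
    refine eq_of_natCast_succ_smul_eq (k := k) ?_
    calc ((k + 1 : ℕ) : ℝ) • B p q = B (numberOp partialOp varOp p) q := by
          rw [hp.numberOp_varOp, map_smul, LinearMap.smul_apply]
      _ = ∑ j, B (partialOp j p) (partialOp j q) := by
          simp only [numberOp, LinearMap.sum_apply, Module.End.mul_apply, map_sum, hB.adjoint]
      _ = ∑ j, B' (partialOp j p) (partialOp j q) :=
          Finset.sum_congr rfl fun j _ => ih (hp.map_partialOp j) (hq.map_partialOp j)
      _ = B' (numberOp partialOp gaussOp p) q := by
          simp only [numberOp, LinearMap.sum_apply, Module.End.mul_apply, map_sum, hB'.adjoint]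
      _ = ((k + 1 : ℕ) : ℝ) • B' p q := by
          rw [hp.numberOp_gaussOp, map_smul, LinearMap.smul_apply]

theorem IsHarmonic.functional_eq_aeval {S : ScalarPoly m →ₗ[ℝ] ℂ} {z : Fin m → ℂ}
    (hone : S 1 = 1) (hS : ∀ j p, S (gaussOp j p) = z j * S p) {k : ℕ} {p : ScalarPoly m}
    (hp : IsHarmonic k p) : S p = MvPolynomial.aeval z p := by
  induction k generalizing p with
  | zero =>
    obtain ⟨c, rfl⟩ := hp.eq_smul_one
    rw [map_smul, hone, map_smul, map_one]
  | succ k ih =>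
    refine eq_of_natCast_succ_smul_eq (k := k) ?_
    calc ((k + 1 : ℕ) : ℝ) • S p = S (numberOp partialOp gaussOp p) := by
          rw [hp.numberOp_gaussOp, map_smul]
      _ = ∑ j, z j * MvPolynomial.aeval z (partialOp j p) := by
          simp only [numberOp, LinearMap.sum_apply, Module.End.mul_apply, map_sum, hS,
            ih (hp.map_partialOp _)]
      _ = MvPolynomial.aeval z (numberOp partialOp varOp p) := by
          simp only [numberOp, LinearMap.sum_apply, Module.End.mul_apply, varOp_apply, map_sum,
            map_mul, MvPolynomial.aeval_X]
      _ = ((k + 1 : ℕ) : ℝ) • MvPolynomial.aeval z p := by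
          rw [hp.numberOp_varOp, map_smul]

/-- A Clifford polynomial as an element of the tensor product. -/
def CliffordPoly.toTensor (P : CliffordPoly m) : TensorPoly m := ∑ A, P A ⊗ₜ blade ℝ A

theorem component_toTensor (A : Finset (Fin m)) (P : CliffordPoly m) :
    component A P.toTensor = P A := by
  simp only [CliffordPoly.toTensor, map_sum, component_tmul, repr_blade, Finsupp.single_apply,
    ite_smul, one_smul, zero_smul, Finset.sum_ite_eq', Finset.mem_univ, if_true]

/-- The evaluation of scalar polynomials at a real point. -/
def evalAt (x : EuclideanSpace ℝ (Fin m)) : ScalarPoly m →ₗ[ℝ] ℝ :=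
  (MvPolynomial.aeval fun j => x j).toLinearMap

/-- The evaluation of scalar polynomials at a complex point. -/
def evalAtComplex (z : Fin m → ℂ) : ScalarPoly m →ₗ[ℝ] ℂ := (MvPolynomial.aeval z).toLinearMap

theorem evalAt_apply (x : EuclideanSpace ℝ (Fin m)) (p : ScalarPoly m) :
    evalAt x p = MvPolynomial.eval (fun j => x j) p := by
  rw [evalAt, AlgHom.toLinearMap_apply, MvPolynomial.aeval_eq_eval]

theorem evalAtComplex_apply (z : Fin m → ℂ) (p : ScalarPoly m) :
    evalAtComplex z p = MvPolynomial.aeval z p := rfl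

theorem evalReal_eq (P : CliffordPoly m) (x : EuclideanSpace ℝ (Fin m)) :
    P.evalReal x = applyReal (evalAt x) P.toTensor := by
  simp only [cliffordExtension_eq_sum, component_toTensor, evalAt_apply, AlgHom.id_apply,
    CliffordPoly.evalReal]

theorem evalComplex_eq (P : CliffordPoly m) (z : Fin m → ℂ) :
    P.evalComplex z = applyComplex (evalAtComplex z) P.toTensor := by
  simp only [cliffordExtension_eq_sum, component_toTensor, evalAtComplex_apply,
    complexifyHom_blade, CliffordPoly.evalComplex]

theorem vecPowMul_eq (l : ℕ) (P : CliffordPoly m) (z : Fin m → ℂ) :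
    vecPowMul l P z = applyComplex (evalAtComplex z) ((cliffOp varOp ^ l) P.toTensor) := by
  rw [applyComplex_cliffOp_pow (z := z), vecPowMul, evalComplex_eq]
  intro j p
  rw [evalAtComplex_apply, varOp_apply, map_mul, MvPolynomial.aeval_X, evalAtComplex_apply]

theorem eq_of_applyReal_evalAt_eq {u v : TensorPoly m}
    (h : ∀ x, applyReal (evalAt x) u = applyReal (evalAt x) v) : u = v := by
  refine component_ext fun A => MvPolynomial.funext fun x => ?_
  have := congrArg (fun a => (bladeBasis ℝ m).repr a A) (h (WithLp.toLp 2 x))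
  simpa only [repr_applyReal, evalAt_apply] using this

end Polynomials

/-! ### Gaussian integrals -/

section TensorIntegrals

open scoped TensorProduct

variable {X V V' C C' W : Type*} [MeasurableSpace X] {μ : Measure X} [AddCommGroup V] [Module ℝ V]
  [AddCommGroup V'] [Module ℝ V'] [AddCommGroup C] [Module ℝ C] [AddCommGroup C'] [Module ℝ C']
  [NormedAddCommGroup W] [NormedSpace ℝ W]

theorem integral_linearMap_tensor {L : X → V ⊗[ℝ] C →ₗ[ℝ] W} {I : V ⊗[ℝ] C →ₗ[ℝ] W}
    (h : ∀ p a, Integrable (fun x => L x (p ⊗ₜ a)) μ ∧ ∫ x, L x (p ⊗ₜ a) ∂μ = I (p ⊗ₜ a))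
    (u : V ⊗[ℝ] C) : Integrable (fun x => L x u) μ ∧ ∫ x, L x u ∂μ = I u := by
  induction u using TensorProduct.induction_on with
  | zero =>
    simp only [map_zero, integral_zero, and_true]
    exact integrable_zero X W μ
  | tmul p a => exact h p a
  | add u v hu hv =>
    simp only [map_add]
    exact ⟨hu.1.add hv.1, by rw [integral_add hu.1 hv.1, hu.2, hv.2]⟩

theorem integral_bilinear_tensor {L : X → V ⊗[ℝ] C →ₗ[ℝ] V' ⊗[ℝ] C' →ₗ[ℝ] W}
    {I : V ⊗[ℝ] C →ₗ[ℝ] V' ⊗[ℝ] C' →ₗ[ℝ] W}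
    (h : ∀ p a q b, Integrable (fun x => L x (p ⊗ₜ a) (q ⊗ₜ b)) μ ∧
      ∫ x, L x (p ⊗ₜ a) (q ⊗ₜ b) ∂μ = I (p ⊗ₜ a) (q ⊗ₜ b)) (u : V ⊗[ℝ] C) (v : V' ⊗[ℝ] C') :
    ∫ x, L x u v ∂μ = I u v :=
  (integral_linearMap_tensor (L := fun x => (L x).flip v) (I := I.flip v)
    (fun p a => integral_linearMap_tensor (h p a) v) u).2

end TensorIntegrals

section GaussianIntegrals

variable {m : ℕ}

/-- The Gaussian kernel `exp(-w² / 2 + x w - x² / 2)` in one variable. -/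
def gaussKernelOne (w : ℂ) (x : ℝ) : ℂ := Complex.exp (-(w * w) / 2 + x * w - x * x / 2)

theorem hasDerivAt_gaussKernelOne (w : ℂ) (x : ℝ) :
    HasDerivAt (gaussKernelOne w) ((w - x) * gaussKernelOne w x) x := by
  have hx : HasDerivAt (fun x : ℝ => (x : ℂ)) 1 x := Complex.ofRealCLM.hasDerivAt
  have hexp := (((hx.mul_const w).const_add (-(w * w) / 2)).sub ((hx.mul hx).div_const 2)).cexp
  refine hexp.congr_deriv ?_
  rw [mul_comm]
  congr 1
  ring

theorem abs_pow_le_factorial_mul_exp_add_exp (n : ℕ) (x : ℝ) :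
    |x| ^ n ≤ n.factorial * (Real.exp x + Real.exp (-x)) := by
  have hpow : |x| ^ n ≤ n.factorial * Real.exp |x| := by
    have := Real.pow_div_factorial_le_exp |x| (abs_nonneg x) n
    rwa [div_le_iff₀' (by positivity)] at this
  have habs : Real.exp |x| ≤ Real.exp x + Real.exp (-x) := by
    rcases abs_cases x with ⟨hx, _⟩ | ⟨hx, _⟩ <;> rw [hx] <;>
      linarith [Real.exp_pos x, Real.exp_pos (-x)]
  exact hpow.trans (mul_le_mul_of_nonneg_left habs (by positivity))

theorem integrable_pow_mul_gaussKernelOne (w : ℂ) (n : ℕ) :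
    Integrable fun x : ℝ => (x : ℂ) ^ n * gaussKernelOne w x := by
  have hexp (s : ℂ) : Integrable fun x : ℝ => Complex.exp (s * x) * gaussKernelOne w x := by
    have := integrable_cexp_quadratic' (b := -1 / 2) (by norm_num) (s + w) (-(w * w) / 2)
    refine this.congr (Filter.Eventually.of_forall fun x => ?_)
    simp only [gaussKernelOne]
    rw [← Complex.exp_add]
    congr 1
    ring
  have hcont : Continuous (gaussKernelOne w) :=
    continuous_iff_continuousAt.2 fun x => (hasDerivAt_gaussKernelOne w x).continuousAt
  refine Integrable.mono' (((hexp 1).norm.add (hexp (-1)).norm).const_mul (n.factorial : ℝ))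
    (by fun_prop) (Filter.Eventually.of_forall fun x => ?_)
  simp only [Pi.add_apply, norm_mul, norm_pow, Complex.norm_real, Real.norm_eq_abs,
    Complex.norm_exp, one_mul, neg_mul, Complex.neg_re, Complex.ofReal_re]
  rw [← add_mul, ← mul_assoc]
  exact mul_le_mul_of_nonneg_right (abs_pow_le_factorial_mul_exp_add_exp n x) (norm_nonneg _)

/-- The `n`-th moment of the Gaussian kernel in one variable. -/
def gaussMoment (w : ℂ) (n : ℕ) : ℂ :=
  (√(2 * Real.pi))⁻¹ • ∫ x : ℝ, (x : ℂ) ^ n * gaussKernelOne w x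

theorem integral_gaussKernelOne (w : ℂ) : ∫ x, gaussKernelOne w x = √(2 * Real.pi) := by
  have hquad (x : ℝ) : gaussKernelOne w x =
      Complex.exp (-1 / 2 * (x : ℂ) ^ 2 + w * x + -(w * w) / 2) := by
    rw [gaussKernelOne]
    congr 1
    ring
  have hexponent : -(w * w) / 2 - w ^ 2 / (4 * (-1 / 2)) = 0 := by ring
  have hbase : (Real.pi : ℂ) / -(-1 / 2) = ((2 * Real.pi : ℝ) : ℂ) := by
    push_cast
    ring
  have hsqrt : ((2 * Real.pi : ℝ) : ℂ) ^ (1 / 2 : ℂ) = (√(2 * Real.pi) : ℝ) := by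
    rw [Real.sqrt_eq_rpow, Complex.ofReal_cpow (by positivity)]
    norm_num
  rw [funext hquad, integral_cexp_quadratic (by norm_num), hexponent, hbase, hsqrt,
    Complex.exp_zero, mul_one]

theorem gaussMoment_zero (w : ℂ) : gaussMoment w 0 = 1 := by
  simp only [gaussMoment, pow_zero, one_mul, integral_gaussKernelOne]
  rw [Complex.real_smul, ← Complex.ofReal_mul, inv_mul_cancel₀ (by positivity),
    Complex.ofReal_one]

-- The integral of the derivative of `xⁿ exp(-w² / 2 + x w - x² / 2)` vanishes.
theorem gaussMoment_succ (w : ℂ) (n : ℕ) :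
    gaussMoment w (n + 1) = w * gaussMoment w n + n * gaussMoment w (n - 1) := by
  have hderiv (x : ℝ) : HasDerivAt (fun x : ℝ => (x : ℂ) ^ n * gaussKernelOne w x)
      (w * ((x : ℂ) ^ n * gaussKernelOne w x) + n * ((x : ℂ) ^ (n - 1) * gaussKernelOne w x) -
        (x : ℂ) ^ (n + 1) * gaussKernelOne w x) x := by
    have hx : HasDerivAt (fun x : ℝ => (x : ℂ)) 1 x := Complex.ofRealCLM.hasDerivAt
    refine ((hx.pow n).mul (hasDerivAt_gaussKernelOne w x)).congr_deriv ?_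
    simp only [Pi.pow_apply]
    ring
  have hint := integrable_pow_mul_gaussKernelOne w
  have hsame := (hint n).const_mul w
  have hprev := (hint (n - 1)).const_mul (n : ℂ)
  have hsum : Integrable fun x : ℝ => w * ((x : ℂ) ^ n * gaussKernelOne w x) +
      n * ((x : ℂ) ^ (n - 1) * gaussKernelOne w x) := hsame.add hprev
  have hzero := integral_eq_zero_of_hasDerivAt_of_integrable hderiv
    (hsum.sub (hint (n + 1))) (hint n)
  rw [integral_sub hsum (hint (n + 1)), integral_add hsame hprev, integral_const_mul,
    integral_const_mul, sub_eq_zero] at hzero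
  simp only [gaussMoment, ← hzero, Complex.real_smul]
  ring

/-- The kernel `exp(-z⬝z / 2 + x⬝z - x⬝x / 2)`. -/
def gaussKernel (z : Fin m → ℂ) (x : EuclideanSpace ℝ (Fin m)) : ℂ :=
  Complex.exp (-(∑ j, z j * z j) / 2 + ∑ j, (x j : ℂ) * z j - (∑ j, (x j : ℂ) * (x j : ℂ)) / 2)

theorem gaussKernel_eq_prod (z : Fin m → ℂ) (x : EuclideanSpace ℝ (Fin m)) :
    gaussKernel z x = ∏ j, gaussKernelOne (z j) (x j) := by
  simp only [gaussKernel, gaussKernelOne, ← Complex.exp_sum, Finset.sum_add_distrib,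
    Finset.sum_sub_distrib, ← Finset.sum_div, Finset.sum_neg_distrib]

theorem gaussKernel_mul_monomial (z : Fin m → ℂ) (s : Fin m →₀ ℕ) (c : ℝ)
    (x : EuclideanSpace ℝ (Fin m)) :
    gaussKernel z x * evalAt x (MvPolynomial.monomial s c) =
      c * ∏ j, ((x j : ℂ) ^ s j * gaussKernelOne (z j) (x j)) := by
  rw [evalAt_apply, MvPolynomial.eval_monomial, Finsupp.prod_fintype _ _ fun i => pow_zero _,
    gaussKernel_eq_prod, Finset.prod_mul_distrib]
  push_cast
  ring

theorem integrable_gaussKernel_mul (z : Fin m → ℂ) (p : ScalarPoly m) :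
    Integrable fun x : EuclideanSpace ℝ (Fin m) => gaussKernel z x * evalAt x p := by
  induction p using MvPolynomial.induction_on' with
  | monomial s c =>
    simp only [gaussKernel_mul_monomial]
    refine Integrable.const_mul ?_ _
    rw [← (PiLp.volume_preserving_toLp (Fin m)).integrable_comp_emb
      (MeasurableEquiv.toLp 2 _).measurableEmbedding]
    exact Integrable.fintype_prod (f := fun j (t : ℝ) => (t : ℂ) ^ s j * gaussKernelOne (z j) t)
      fun j => integrable_pow_mul_gaussKernelOne (z j) (s j)
  | add p q hp hq =>
    simp only [map_add, Complex.ofReal_add, mul_add]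
    exact hp.add hq

/-- The functional `p ↦ (2π) ^ (-m/2) ∫ exp(-z⬝z / 2 + x⬝z - x⬝x / 2) p(x) dx`. -/
def gaussFunctional (z : Fin m → ℂ) : ScalarPoly m →ₗ[ℝ] ℂ where
  toFun p := (√(2 * Real.pi) ^ m)⁻¹ • ∫ x : EuclideanSpace ℝ (Fin m),
    gaussKernel z x * evalAt x p
  map_add' p q := by
    simp only [map_add, Complex.ofReal_add, mul_add]
    rw [integral_add (integrable_gaussKernel_mul z p) (integrable_gaussKernel_mul z q), smul_add]
  map_smul' c p := by
    simp only [map_smul, smul_eq_mul, Complex.ofReal_mul, mul_left_comm _ (c : ℂ)]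
    rw [integral_const_mul, RingHom.id_apply, ← Complex.real_smul, smul_comm]

theorem gaussFunctional_apply (z : Fin m → ℂ) (p : ScalarPoly m) :
    gaussFunctional z p = (√(2 * Real.pi) ^ m)⁻¹ • ∫ x : EuclideanSpace ℝ (Fin m),
      gaussKernel z x * evalAt x p := rfl

theorem gaussFunctional_monomial (z : Fin m → ℂ) (s : Fin m →₀ ℕ) (c : ℝ) :
    gaussFunctional z (MvPolynomial.monomial s c) = c * ∏ j, gaussMoment (z j) (s j) := by
  have hprod : ∫ x : EuclideanSpace ℝ (Fin m), ∏ j, ((x j : ℂ) ^ s j * gaussKernelOne (z j) (x j)) =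
      ∏ j, ∫ t : ℝ, (t : ℂ) ^ s j * gaussKernelOne (z j) t := by
    rw [← (PiLp.volume_preserving_toLp (Fin m)).integral_comp
      (MeasurableEquiv.toLp 2 _).measurableEmbedding]
    exact integral_fintype_prod_volume_eq_prod
      (f := fun (j : Fin m) (t : ℝ) => (t : ℂ) ^ s j * gaussKernelOne (z j) t)
  simp only [gaussFunctional_apply, gaussKernel_mul_monomial, gaussMoment, Finset.prod_smul,
    Finset.prod_const, Finset.card_univ, Fintype.card_fin, inv_pow]
  rw [integral_const_mul, hprod, mul_smul_comm]

theorem gaussFunctional_one (z : Fin m → ℂ) : gaussFunctional z 1 = 1 := by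
  simpa only [MvPolynomial.monomial_zero', MvPolynomial.C_1, Finsupp.coe_zero, Pi.zero_apply,
    gaussMoment_zero, Finset.prod_const_one, mul_one, Complex.ofReal_one] using
    gaussFunctional_monomial z 0 1

theorem X_mul_monomial {R σ : Type*} [CommSemiring R] (j : σ) (s : σ →₀ ℕ) (c : R) :
    MvPolynomial.X j * MvPolynomial.monomial s c =
      MvPolynomial.monomial (s + Finsupp.single j 1) c := by
  rw [MvPolynomial.monomial_add_single, pow_one, mul_comm]

theorem prod_eq_mul_prod_erase {ι M : Type*} [Fintype ι] [DecidableEq ι] [CommMonoid M]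
    (f : ι → ℕ → M) {s t : ι →₀ ℕ} {j : ι} (h : ∀ i ≠ j, t i = s i) :
    ∏ i, f i (t i) = f j (t j) * ∏ i ∈ Finset.univ.erase j, f i (s i) := by
  rw [← Finset.mul_prod_erase _ _ (Finset.mem_univ j)]
  congr 1
  exact Finset.prod_congr rfl fun i hi => by rw [h i (Finset.ne_of_mem_erase hi)]

theorem add_single_apply_of_ne {ι : Type*} (s : ι →₀ ℕ) (j i : ι) (hij : i ≠ j) :
    (s + Finsupp.single j 1 : ι →₀ ℕ) i = s i := by
  rw [Finsupp.add_apply, Finsupp.single_eq_of_ne hij, add_zero]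

theorem sub_single_apply_of_ne {ι : Type*} (s : ι →₀ ℕ) (j i : ι) (hij : i ≠ j) :
    (s - Finsupp.single j 1 : ι →₀ ℕ) i = s i := by
  rw [Finsupp.tsub_apply, Finsupp.single_eq_of_ne hij, tsub_zero]

theorem gaussFunctional_X_mul (z : Fin m → ℂ) (j : Fin m) (p : ScalarPoly m) :
    gaussFunctional z (MvPolynomial.X j * p) =
      z j * gaussFunctional z p + gaussFunctional z (MvPolynomial.pderiv j p) := by
  induction p using MvPolynomial.induction_on' with
  | monomial s c =>
    rw [X_mul_monomial, MvPolynomial.pderiv_monomial]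
    simp only [gaussFunctional_monomial]
    rw [prod_eq_mul_prod_erase (fun i n => gaussMoment (z i) n) (add_single_apply_of_ne s j),
      prod_eq_mul_prod_erase (fun i n => gaussMoment (z i) n) (sub_single_apply_of_ne s j),
      ← Finset.mul_prod_erase _ _ (Finset.mem_univ j)]
    simp only [Finsupp.add_apply, Finsupp.tsub_apply, Finsupp.single_eq_same, gaussMoment_succ]
    push_cast
    ring
  | add p q hp hq =>
    simp only [mul_add, map_add, hp, hq]
    ring

theorem gaussFunctional_gaussOp (z : Fin m → ℂ) (j : Fin m) (p : ScalarPoly m) :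
    gaussFunctional z (gaussOp j p) = z j * gaussFunctional z p := by
  rw [gaussOp_apply, map_sub, gaussFunctional_X_mul, add_sub_cancel_right]

theorem integral_gaussKernel_smul (z : Fin m → ℂ) (u : TensorPoly m) :
    ∫ x : EuclideanSpace ℝ (Fin m), gaussKernel z x • complexifyHom m (applyReal (evalAt x) u) =
      √(2 * Real.pi) ^ m • applyComplex (gaussFunctional z) u := by
  refine (integral_linearMap_tensor (L := fun x => (Algebra.lsmul ℝ ℝ (Cl ℂ m) (gaussKernel z x)) ∘ₗ
    (complexifyHom m).toLinearMap ∘ₗ applyReal (evalAt x))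
    (I := √(2 * Real.pi) ^ m • applyComplex (gaussFunctional z)) (fun p a => ?_) u).2
  have htmul (x : EuclideanSpace ℝ (Fin m)) :
      (Algebra.lsmul ℝ ℝ (Cl ℂ m) (gaussKernel z x) ∘ₗ (complexifyHom m).toLinearMap ∘ₗ
        applyReal (evalAt x)) (p ⊗ₜ a) =
      (gaussKernel z x * evalAt x p) • complexifyHom m a := by
    rw [LinearMap.comp_apply, LinearMap.comp_apply, cliffordExtension_tmul,
      AlgHom.toLinearMap_apply, map_smul, mul_smul, Complex.coe_smul]
    rfl
  simp only [htmul]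
  refine ⟨(integrable_gaussKernel_mul z p).smul_const _, ?_⟩
  rw [integral_smul_const, LinearMap.smul_apply, cliffordExtension_tmul, gaussFunctional_apply,
    smul_assoc, smul_inv_smul₀ (by positivity)]

/-- The bilinear form `(2π) ^ (-m/2) ∫ p(x) q(x) exp(-|x|² / 2) dx`. -/
def gaussForm (m : ℕ) : ScalarPoly m →ₗ[ℝ] ScalarPoly m →ₗ[ℝ] ℝ :=
  (LinearMap.mul ℝ (ScalarPoly m)).compr₂ (Complex.reLm ∘ₗ gaussFunctional 0)

theorem gaussForm_apply (p q : ScalarPoly m) :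
    gaussForm m p q = (gaussFunctional 0 (p * q)).re := rfl

theorem isAdjointForm_gaussForm : IsAdjointForm partialOp gaussOp (gaussForm m) where
  symm p q := by rw [gaussForm_apply, gaussForm_apply, mul_comm]
  adjoint j p q := by
    have hX := gaussFunctional_X_mul 0 j (p * q)
    rw [Pi.zero_apply, zero_mul, zero_add, Derivation.leibniz, map_add, smul_eq_mul,
      smul_eq_mul] at hX
    rw [gaussForm_apply, gaussForm_apply, gaussOp_apply, partialOp_apply, sub_mul, map_sub,
      mul_assoc, hX, mul_comm q, add_sub_cancel_right]

theorem gaussForm_one_one : gaussForm m 1 1 = 1 := by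
  rw [gaussForm_apply, mul_one, gaussFunctional_one, Complex.one_re]

theorem gaussKernel_zero (x : EuclideanSpace ℝ (Fin m)) :
    gaussKernel 0 x = (Real.exp (-‖x‖ ^ 2 / 2) : ℝ) := by
  rw [gaussKernel, EuclideanSpace.real_norm_sq_eq, Complex.ofReal_exp]
  congr 1
  simp only [Pi.zero_apply, mul_zero, Finset.sum_const_zero, neg_zero, zero_div, zero_add,
    zero_sub, sq]
  push_cast
  ring

theorem integrable_exp_mul_evalAt (p : ScalarPoly m) :
    Integrable fun x : EuclideanSpace ℝ (Fin m) => Real.exp (-‖x‖ ^ 2 / 2) * evalAt x p := by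
  have hre := (integrable_gaussKernel_mul 0 p).re
  simp only [gaussKernel_zero, ← Complex.ofReal_mul] at hre
  exact hre

theorem integral_exp_mul_evalAt (p q : ScalarPoly m) :
    ∫ x : EuclideanSpace ℝ (Fin m), Real.exp (-‖x‖ ^ 2 / 2) * evalAt x (p * q) =
      √(2 * Real.pi) ^ m * gaussForm m p q := by
  rw [gaussForm_apply, gaussFunctional_apply]
  simp only [gaussKernel_zero, ← Complex.ofReal_mul]
  rw [integral_complex_ofReal, Complex.real_smul, ← Complex.ofReal_mul, Complex.ofReal_re,
    mul_inv_cancel_left₀ (by positivity)]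

theorem integral_exp_smul_dagger_mul (u v : TensorPoly m) :
    ∫ x : EuclideanSpace ℝ (Fin m), Real.exp (-‖x‖ ^ 2 / 2) •
      (dagger (applyReal (evalAt x) u) * applyReal (evalAt x) v) =
        √(2 * Real.pi) ^ m • pairing (gaussForm m) u v := by
  refine integral_bilinear_tensor (L := fun x => Real.exp (-‖x‖ ^ 2 / 2) •
    ((LinearMap.mul ℝ (Cl ℝ m)).comp (daggerₗ ℝ m)).compl₁₂ (applyReal (evalAt x))
      (applyReal (evalAt x))) (I := √(2 * Real.pi) ^ m • pairing (gaussForm m))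
    (fun p a q b => ?_) u v
  have htmul (x : EuclideanSpace ℝ (Fin m)) : (Real.exp (-‖x‖ ^ 2 / 2) •
      ((LinearMap.mul ℝ (Cl ℝ m)).comp (daggerₗ ℝ m)).compl₁₂ (applyReal (evalAt x))
        (applyReal (evalAt x))) (p ⊗ₜ a) (q ⊗ₜ b) =
      (Real.exp (-‖x‖ ^ 2 / 2) * evalAt x (p * q)) • (dagger a * b) := by
    simp only [LinearMap.smul_apply, LinearMap.compl₁₂_apply, LinearMap.comp_apply,
      cliffordExtension_tmul, AlgHom.id_apply, map_smul, LinearMap.mul_apply', daggerₗ_apply,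
      smul_smul, evalAt_apply, map_mul, mul_assoc, mul_comm]
  simp only [htmul]
  refine ⟨(integrable_exp_mul_evalAt _).smul_const _, ?_⟩
  rw [integral_smul_const, integral_exp_mul_evalAt, mul_smul]
  rfl

end GaussianIntegrals

/-! ### The Fischer form -/

section FockIntegrals

variable {m : ℕ}

/-- The one-dimensional integrand `π⁻¹ exp(-|z|²) conj(z) ^ a z ^ b`. -/
def fockIntegrandOne (a b : ℕ) (z : ℂ) : ℂ :=
  ((Real.exp (-‖z‖ ^ 2) / Real.pi : ℝ) : ℂ) * (starRingEnd ℂ z ^ a * z ^ b)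

theorem integral_norm_pow_mul_exp (n : ℕ) : ∫ z : ℂ, ‖z‖ ^ n * Real.exp (-‖z‖ ^ 2) =
    Real.pi * Real.Gamma ((n + 2) / 2) := by
  have hrpow := Complex.integral_rpow_mul_exp_neg_rpow (p := 2) (q := n) (by norm_num)
    (by linarith [(Nat.cast_nonneg n : (0 : ℝ) ≤ n)])
  simpa only [Real.rpow_natCast, Real.rpow_ofNat, mul_div_cancel_left₀ Real.pi two_ne_zero]
    using hrpow

-- A function with nonzero Bochner integral is integrable.
theorem integrable_norm_pow_mul_exp (n : ℕ) :
    Integrable fun z : ℂ => ‖z‖ ^ n * Real.exp (-‖z‖ ^ 2) := by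
  refine Integrable.of_integral_ne_zero ?_
  rw [integral_norm_pow_mul_exp]
  have : 0 < Real.Gamma (((n : ℝ) + 2) / 2) := Real.Gamma_pos_of_pos (by positivity)
  positivity

theorem continuous_fockIntegrandOne (a b : ℕ) : Continuous (fockIntegrandOne a b) := by
  unfold fockIntegrandOne
  fun_prop

theorem integrable_fockIntegrandOne (a b : ℕ) : Integrable (fockIntegrandOne a b) := by
  refine ((integrable_norm_pow_mul_exp (a + b)).div_const Real.pi).mono'
    (continuous_fockIntegrandOne a b).aestronglyMeasurable (Filter.Eventually.of_forall fun z => ?_)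
  rw [fockIntegrandOne, norm_mul, norm_mul, norm_pow, norm_pow, RCLike.norm_conj,
    Complex.norm_real, Real.norm_of_nonneg (by positivity), ← pow_add]
  exact le_of_eq (by ring)

/-- The moments of the one-dimensional Fock measure. -/
def fockMoment (a b : ℕ) : ℝ := if a = b then a.factorial else 0

theorem fockMoment_succ (a b : ℕ) : fockMoment (a + 1) b = b * fockMoment a (b - 1) := by
  cases b with
  | zero => simp only [fockMoment, Nat.succ_ne_zero, if_false, Nat.cast_zero, zero_mul]
  | succ b =>
    by_cases hab : a = b
    · subst hab
      simp only [fockMoment, if_true, add_tsub_cancel_right, Nat.factorial_succ, Nat.cast_mul]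
    · simp only [fockMoment, add_left_inj, hab, if_false, add_tsub_cancel_right, mul_zero]

theorem fockMoment_comm (a b : ℕ) : fockMoment a b = fockMoment b a := by
  by_cases hab : a = b
  · rw [hab]
  · rw [fockMoment, fockMoment, if_neg hab, if_neg (Ne.symm hab)]

theorem integral_fockIntegrandOne_self (a : ℕ) : ∫ z, fockIntegrandOne a a z = a.factorial := by
  have hnorm (z : ℂ) : fockIntegrandOne a a z =
      ((‖z‖ ^ (2 * a) * Real.exp (-‖z‖ ^ 2) / Real.pi : ℝ) : ℂ) := by
    rw [fockIntegrandOne, ← mul_pow, Complex.conj_mul', ← pow_mul]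
    push_cast
    ring
  have hhalf : (((2 * a : ℕ) : ℝ) + 2) / 2 = a + 1 := by
    push_cast
    ring
  simp only [hnorm]
  rw [integral_complex_ofReal, integral_div, integral_norm_pow_mul_exp,
    mul_div_cancel_left₀ _ Real.pi_ne_zero, hhalf, Real.Gamma_nat_eq_factorial,
    Complex.ofReal_natCast]

-- The rotation by the angle `π / (b - a)` preserves the measure and changes the sign of the
-- integrand.
theorem integral_fockIntegrandOne_of_ne {a b : ℕ} (hab : a ≠ b) :
    ∫ z, fockIntegrandOne a b z = 0 := by
  have hsub : (b : ℂ) - a ≠ 0 := sub_ne_zero.2 (Nat.cast_injective.ne hab.symm)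
  set c : Circle := Circle.exp (Real.pi / (b - a)) with hc
  have hcpow : starRingEnd ℂ (c : ℂ) ^ a * (c : ℂ) ^ b = -1 := by
    rw [hc, Circle.coe_exp, ← Complex.exp_conj, ← Complex.exp_nat_mul, ← Complex.exp_nat_mul,
      ← Complex.exp_add, ← Complex.exp_pi_mul_I]
    congr 1
    rw [map_mul, Complex.conj_I, Complex.conj_ofReal]
    push_cast
    field_simp
    ring
  have hneg (z : ℂ) : fockIntegrandOne a b (rotation c z) = -fockIntegrandOne a b z := by
    rw [rotation_apply, fockIntegrandOne, fockIntegrandOne, norm_mul, Circle.norm_coe, one_mul,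
      map_mul, mul_pow, mul_pow, mul_mul_mul_comm, hcpow]
    ring
  have hinv : ∫ z, fockIntegrandOne a b (rotation c z) = ∫ z, fockIntegrandOne a b z :=
    (rotation c).measurePreserving.integral_comp (rotation c).toHomeomorph.measurableEmbedding _
  simp only [hneg] at hinv
  rw [integral_neg] at hinv
  exact neg_eq_self.1 hinv

theorem integral_fockIntegrandOne (a b : ℕ) : ∫ z, fockIntegrandOne a b z = fockMoment a b := by
  by_cases hab : a = b
  · subst hab
    rw [integral_fockIntegrandOne_self, fockMoment, if_pos rfl, Complex.ofReal_natCast]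
  · rw [integral_fockIntegrandOne_of_ne hab, fockMoment, if_neg hab, Complex.ofReal_zero]

theorem measurable_fockDensity : Measurable fun z : Fin m → ℂ =>
    ENNReal.ofReal (Real.exp (-∑ j, ‖z j‖ ^ 2) / Real.pi ^ m) := by
  fun_prop

theorem toReal_fockDensity (z : Fin m → ℂ) :
    (ENNReal.ofReal (Real.exp (-∑ j, ‖z j‖ ^ 2) / Real.pi ^ m)).toReal =
      Real.exp (-∑ j, ‖z j‖ ^ 2) / Real.pi ^ m :=
  ENNReal.toReal_ofReal (by positivity)

theorem integral_fockMeasure {E : Type*} [NormedAddCommGroup E] [NormedSpace ℝ E]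
    (f : (Fin m → ℂ) → E) : ∫ z, f z ∂fockMeasure m =
      ∫ z : Fin m → ℂ, (Real.exp (-∑ j, ‖z j‖ ^ 2) / Real.pi ^ m) • f z := by
  rw [fockMeasure, integral_withDensity_eq_integral_toReal_smul measurable_fockDensity
    (Filter.Eventually.of_forall fun z => ENNReal.ofReal_lt_top)]
  simp only [toReal_fockDensity]

theorem integrable_fockMeasure_iff {E : Type*} [NormedAddCommGroup E] [NormedSpace ℝ E]
    {f : (Fin m → ℂ) → E} : Integrable f (fockMeasure m) ↔
      Integrable fun z : Fin m → ℂ => (Real.exp (-∑ j, ‖z j‖ ^ 2) / Real.pi ^ m) • f z := by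
  rw [fockMeasure, integrable_withDensity_iff_integrable_smul' measurable_fockDensity
    (Filter.Eventually.of_forall fun z => ENNReal.ofReal_lt_top)]
  simp only [toReal_fockDensity]

theorem evalAtComplex_monomial (z : Fin m → ℂ) (s : Fin m →₀ ℕ) (c : ℝ) :
    evalAtComplex z (MvPolynomial.monomial s c) = c * ∏ j, z j ^ s j := by
  rw [evalAtComplex_apply, MvPolynomial.aeval_monomial,
    Finsupp.prod_fintype _ _ fun i => pow_zero _, Complex.coe_algebraMap]

theorem fockDensity_smul_monomial (s t : Fin m →₀ ℕ) (c d : ℝ) (z : Fin m → ℂ) :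
    (Real.exp (-∑ j, ‖z j‖ ^ 2) / Real.pi ^ m) •
      (starRingEnd ℂ (evalAtComplex z (MvPolynomial.monomial s c)) *
        evalAtComplex z (MvPolynomial.monomial t d)) =
      (c * d : ℂ) * ∏ j, fockIntegrandOne (s j) (t j) (z j) := by
  simp only [fockIntegrandOne, evalAtComplex_monomial, Finset.prod_mul_distrib, map_mul, map_prod,
    map_pow, Complex.conj_ofReal, Complex.real_smul, ← Complex.ofReal_prod, Finset.prod_div_distrib,
    ← Real.exp_sum, Finset.sum_neg_distrib, Finset.prod_const, Finset.card_univ, Fintype.card_fin]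
  ring

theorem integrable_conj_evalAtComplex_mul (p q : ScalarPoly m) :
    Integrable (fun z => starRingEnd ℂ (evalAtComplex z p) * evalAtComplex z q)
      (fockMeasure m) := by
  induction p using MvPolynomial.induction_on' with
  | monomial s c =>
    induction q using MvPolynomial.induction_on' with
    | monomial t d =>
      rw [integrable_fockMeasure_iff]
      simp only [fockDensity_smul_monomial]
      exact (Integrable.fintype_prod (f := fun j => fockIntegrandOne (s j) (t j))
        fun j => integrable_fockIntegrandOne (s j) (t j)).const_mul _
    | add p q hp hq =>
      simp only [map_add, mul_add]
      exact hp.add hq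
  | add p q hp hq =>
    simp only [map_add, add_mul]
    exact hp.add hq

/-- The bilinear form `∫ conj(p) q dμ` for the measure `μ` of the Segal-Bargmann space. -/
def fockForm (m : ℕ) : ScalarPoly m →ₗ[ℝ] ScalarPoly m →ₗ[ℝ] ℂ :=
  LinearMap.mk₂ ℝ
    (fun p q => ∫ z, starRingEnd ℂ (evalAtComplex z p) * evalAtComplex z q ∂fockMeasure m)
    (fun p p' q => by
      simp only [map_add, add_mul]
      exact integral_add (integrable_conj_evalAtComplex_mul p q)
        (integrable_conj_evalAtComplex_mul p' q))
    (fun c p q => by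
      simp only [map_smul, Complex.real_smul, map_mul, Complex.conj_ofReal, mul_assoc]
      exact integral_const_mul _ _)
    (fun p q q' => by
      simp only [map_add, mul_add]
      exact integral_add (integrable_conj_evalAtComplex_mul p q)
        (integrable_conj_evalAtComplex_mul p q'))
    (fun c p q => by
      simp only [map_smul, Complex.real_smul, mul_left_comm _ (c : ℂ)]
      exact integral_const_mul _ _)

theorem fockForm_apply (p q : ScalarPoly m) : fockForm m p q =
    ∫ z, starRingEnd ℂ (evalAtComplex z p) * evalAtComplex z q ∂fockMeasure m := rfl

theorem fockForm_monomial (s t : Fin m →₀ ℕ) (c d : ℝ) :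
    fockForm m (MvPolynomial.monomial s c) (MvPolynomial.monomial t d) =
      ((c * d * ∏ j, fockMoment (s j) (t j) : ℝ) : ℂ) := by
  rw [fockForm_apply, integral_fockMeasure]
  simp only [fockDensity_smul_monomial]
  rw [integral_const_mul, integral_fintype_prod_volume_eq_prod
    (f := fun j => fockIntegrandOne (s j) (t j))]
  simp only [integral_fockIntegrandOne]
  push_cast
  rfl

/-- The Fischer inner product of real polynomials. -/
def fischerForm (m : ℕ) : ScalarPoly m →ₗ[ℝ] ScalarPoly m →ₗ[ℝ] ℝ :=
  (fockForm m).compr₂ Complex.reLm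

theorem fischerForm_monomial (s t : Fin m →₀ ℕ) (c d : ℝ) :
    fischerForm m (MvPolynomial.monomial s c) (MvPolynomial.monomial t d) =
      c * d * ∏ j, fockMoment (s j) (t j) :=
  congrArg Complex.re (fockForm_monomial s t c d)

theorem bilinear_ext_monomial {R σ F : Type*} [CommSemiring R] [AddCommMonoid F] [Module R F]
    {f g : MvPolynomial σ R →ₗ[R] MvPolynomial σ R →ₗ[R] F}
    (h : ∀ s t c d, f (MvPolynomial.monomial s c) (MvPolynomial.monomial t d) =
      g (MvPolynomial.monomial s c) (MvPolynomial.monomial t d)) : f = g :=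
  MvPolynomial.linearMap_ext fun s => LinearMap.ext fun c =>
    MvPolynomial.linearMap_ext fun t => LinearMap.ext fun d => h s t c d

theorem fockForm_eq (p q : ScalarPoly m) : fockForm m p q = (fischerForm m p q : ℝ) := by
  suffices fockForm m = (fischerForm m).compr₂ Complex.ofRealCLM.toLinearMap from
    LinearMap.congr_fun₂ this p q
  exact bilinear_ext_monomial fun s t c d =>
    (fockForm_monomial s t c d).trans (congrArg Complex.ofReal (fischerForm_monomial s t c d).symm)

theorem fischerForm_comm (p q : ScalarPoly m) : fischerForm m p q = fischerForm m q p := by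
  suffices fischerForm m = (fischerForm m).flip from LinearMap.congr_fun₂ this p q
  refine bilinear_ext_monomial fun s t c d => ?_
  simp only [LinearMap.flip_apply, fischerForm_monomial, mul_comm c, fockMoment_comm]

theorem fischerForm_varOp (j : Fin m) (p q : ScalarPoly m) :
    fischerForm m (varOp j p) q = fischerForm m p (partialOp j q) := by
  suffices (fischerForm m).comp (varOp j) = (fischerForm m).compl₂ (partialOp j) from
    LinearMap.congr_fun₂ this p q
  refine bilinear_ext_monomial fun s t c d => ?_
  rw [LinearMap.comp_apply, LinearMap.compl₂_apply, varOp_apply, partialOp_apply, X_mul_monomial,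
    MvPolynomial.pderiv_monomial, fischerForm_monomial, fischerForm_monomial,
    prod_eq_mul_prod_erase (fun i n => fockMoment n (t i)) (add_single_apply_of_ne s j),
    prod_eq_mul_prod_erase (fun i n => fockMoment (s i) n) (sub_single_apply_of_ne t j)]
  simp only [Finsupp.add_apply, Finsupp.tsub_apply, Finsupp.single_eq_same, fockMoment_succ]
  ring

theorem isAdjointForm_fischerForm : IsAdjointForm partialOp varOp (fischerForm m) where
  symm := fischerForm_comm
  adjoint := fischerForm_varOp

theorem fischerForm_one_one : fischerForm m 1 1 = 1 := by
  simpa only [MvPolynomial.monomial_zero', MvPolynomial.C_1, Finsupp.coe_zero, Pi.zero_apply,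
    fockMoment, if_true, Nat.factorial_zero, Nat.cast_one, Finset.prod_const_one, mul_one] using
    fischerForm_monomial (m := m) 0 0 1 1

theorem integral_dagger_applyComplex_mul (u v : TensorPoly m) :
    ∫ z, dagger (applyComplex (evalAtComplex z) u) * applyComplex (evalAtComplex z) v
      ∂fockMeasure m = complexifyHom m (pairing (fischerForm m) u v) := by
  let daggerR : Cl ℂ m →ₗ[ℝ] Cl ℂ m := ⟨⟨dagger, dagger_add⟩, dagger_real_smul⟩
  refine integral_bilinear_tensor (L := fun z => ((LinearMap.mul ℝ (Cl ℂ m)).comp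
    daggerR).compl₁₂ (applyComplex (evalAtComplex z)) (applyComplex (evalAtComplex z)))
    (I := (pairing (fischerForm m)).compr₂ (complexifyHom m).toLinearMap)
    (fun p a q b => ?_) u v
  have htmul (z : Fin m → ℂ) : ((LinearMap.mul ℝ (Cl ℂ m)).comp daggerR).compl₁₂
      (applyComplex (evalAtComplex z)) (applyComplex (evalAtComplex z)) (p ⊗ₜ a) (q ⊗ₜ b) =
      (starRingEnd ℂ (evalAtComplex z p) * evalAtComplex z q) •
        complexifyHom m (dagger a * b) := by
    rw [map_mul, ← dagger_complexifyHom, ← smul_mul_smul_comm, ← dagger_smul]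
    rfl
  simp only [htmul]
  refine ⟨(integrable_conj_evalAtComplex_mul p q).smul_const _, ?_⟩
  rw [integral_smul_const, ← fockForm_apply, fockForm_eq, LinearMap.compr₂_apply, pairing_tmul,
    AlgHom.toLinearMap_apply, map_smul, Complex.coe_smul]

end FockIntegrals

/-! ### The Dirac operator and the Clifford-Hermite functions -/

section DiracOperator

variable {m : ℕ}

theorem hasLineDerivAt_eval (j : Fin m) (p : ScalarPoly m) (x : EuclideanSpace ℝ (Fin m)) :
    HasLineDerivAt ℝ (fun y => evalAt y p) (evalAt x (partialOp j p)) x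
      (EuclideanSpace.single j 1) := by
  simp only [evalAt_apply, partialOp_apply]
  unfold HasLineDerivAt
  induction p using MvPolynomial.induction_on with
  | C c => simpa only [MvPolynomial.eval_C, MvPolynomial.pderiv_C, map_zero] using
      hasDerivAt_const (0 : ℝ) c
  | add p q hp hq =>
    simp only [map_add]
    exact hp.add hq
  | mul_X p i hp =>
    have hX : HasDerivAt (fun t : ℝ => (x + t • EuclideanSpace.single j (1 : ℝ)) i)
        (EuclideanSpace.single j (1 : ℝ) i) 0 :=
      (((hasDerivAt_id (0 : ℝ)).mul_const _).const_add (x i)).congr_deriv (one_mul _)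
    simp only [map_mul, MvPolynomial.eval_X]
    refine (hp.mul hX).congr_deriv ?_
    rw [Derivation.leibniz, MvPolynomial.pderiv_X]
    by_cases hij : i = j
    · subst hij
      simp only [PiLp.single_apply, if_true, Pi.single_eq_same, zero_smul, add_zero, mul_one,
        smul_eq_mul, map_add, map_mul, MvPolynomial.eval_X]
      ring
    · simp only [PiLp.single_apply, if_neg hij, Pi.single_eq_of_ne hij, zero_smul, add_zero,
        mul_zero, zero_add, smul_eq_mul, map_mul, MvPolynomial.eval_X]
      ring

theorem hasLineDerivAt_exp_norm_sq (j : Fin m) (x : EuclideanSpace ℝ (Fin m)) :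
    HasLineDerivAt ℝ (fun y : EuclideanSpace ℝ (Fin m) => Real.exp (-‖y‖ ^ 2 / 2))
      (-(x j) * Real.exp (-‖x‖ ^ 2 / 2)) x (EuclideanSpace.single j 1) := by
  have hnorm : HasLineDerivAt ℝ (fun y : EuclideanSpace ℝ (Fin m) => -‖y‖ ^ 2 / 2) (-(x j)) x
      (EuclideanSpace.single j 1) := by
    refine (((hasStrictFDerivAt_norm_sq x).hasFDerivAt.neg.mul_const (2⁻¹ : ℝ)).hasLineDerivAt
      _).congr_deriv ?_
    simp only [smul_neg, neg_apply, smul_apply, coe_innerSL_apply,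
      EuclideanSpace.inner_single_right, Real.ringHom_apply, one_mul, nsmul_eq_mul,
      Nat.cast_ofNat, smul_eq_mul, ne_eq, OfNat.ofNat_ne_zero, not_false_eq_true,
      inv_mul_cancel_left₀]
  refine (HasDerivAt.exp hnorm).congr_deriv ?_
  rw [zero_smul, add_zero, mul_comm]

theorem hasLineDerivAt_applyReal (j : Fin m) (u : TensorPoly m) (x : EuclideanSpace ℝ (Fin m)) :
    HasLineDerivAt ℝ (fun y => applyReal (evalAt y) u)
      (applyReal (evalAt x ∘ₗ partialOp j) u) x (EuclideanSpace.single j 1) := by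
  simp only [cliffordExtension_eq_sum]
  exact HasDerivAt.fun_sum fun A _ =>
    HasDerivAt.smul_const (hasLineDerivAt_eval j (component A u) x) _

theorem hasLineDerivAt_exp_smul_applyReal (j : Fin m) (u : TensorPoly m)
    (x : EuclideanSpace ℝ (Fin m)) :
    HasLineDerivAt ℝ (fun y => Real.exp (-‖y‖ ^ 2 / 2) • applyReal (evalAt y) u)
      (-(Real.exp (-‖x‖ ^ 2 / 2) • applyReal (evalAt x ∘ₗ gaussOp j) u)) x
      (EuclideanSpace.single j 1) := by
  have hgauss : evalAt x ∘ₗ gaussOp j = x j • evalAt x - evalAt x ∘ₗ partialOp j :=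
    LinearMap.ext fun p => by
      simp only [LinearMap.comp_apply, gaussOp_apply, LinearMap.sub_apply, LinearMap.smul_apply,
        evalAt_apply, map_sub, map_mul, MvPolynomial.eval_X, smul_eq_mul, partialOp_apply]
  have happly : applyReal (evalAt x ∘ₗ gaussOp j) u =
      x j • applyReal (evalAt x) u - applyReal (evalAt x ∘ₗ partialOp j) u := by
    simp only [hgauss, cliffordExtension_eq_sum, LinearMap.sub_apply, LinearMap.smul_apply,
      sub_smul, smul_assoc, Finset.sum_sub_distrib, Finset.smul_sum]
  refine (HasDerivAt.fun_smul (hasLineDerivAt_exp_norm_sq j x)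
    (hasLineDerivAt_applyReal j u x)).congr_deriv ?_
  rw [happly, zero_smul, add_zero]
  module

theorem dirac_applyReal (u : TensorPoly m) (x : EuclideanSpace ℝ (Fin m)) :
    dirac (fun y => applyReal (evalAt y) u) x = applyReal (evalAt x) (cliffOp partialOp u) := by
  simp only [dirac, (hasLineDerivAt_applyReal _ u x).lineDeriv, cliffordExtension_cliffOp,
    AlgHom.id_apply]

theorem dirac_exp_smul_applyReal (u : TensorPoly m) :
    dirac (fun y => Real.exp (-‖y‖ ^ 2 / 2) • applyReal (evalAt y) u) =
      fun x => Real.exp (-‖x‖ ^ 2 / 2) • applyReal (evalAt x) (-cliffOp gaussOp u) := by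
  funext x
  simp only [dirac, (hasLineDerivAt_exp_smul_applyReal _ u x).lineDeriv, map_neg,
    cliffordExtension_cliffOp, AlgHom.id_apply, smul_neg, mul_neg, Finset.sum_neg_distrib,
    Finset.smul_sum, mul_smul_comm]

theorem dirac_iterate_exp_smul (l : ℕ) (u : TensorPoly m) :
    dirac^[l] (fun y => Real.exp (-‖y‖ ^ 2 / 2) • applyReal (evalAt y) u) =
      fun x => Real.exp (-‖x‖ ^ 2 / 2) •
        applyReal (evalAt x) ((-1 : ℝ) ^ l • (cliffOp gaussOp ^ l) u) := by
  induction l generalizing u with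
  | zero => simp only [Function.iterate_zero, id_eq, pow_zero, Module.End.one_apply, one_smul]
  | succ l ih =>
    rw [Function.iterate_succ_apply, dirac_exp_smul_applyReal, ih]
    funext x
    rw [pow_succ (cliffOp gaussOp), Module.End.mul_apply, pow_succ (-1 : ℝ)]
    simp only [map_smul, map_neg, mul_neg_one, neg_smul, smul_neg]

theorem hermitePoly_eq (l : ℕ) (P : CliffordPoly m) (x : EuclideanSpace ℝ (Fin m)) :
    hermitePoly l P x = applyReal (evalAt x) ((cliffOp gaussOp ^ l) P.toTensor) := by
  have hexp : Real.exp (‖x‖ ^ 2 / 2) * Real.exp (-‖x‖ ^ 2 / 2) = 1 := by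
    rw [← Real.exp_add, neg_div, add_neg_cancel, Real.exp_zero]
  have hsign : (-1 : ℝ) ^ l * (-1) ^ l = 1 := by
    rw [← mul_pow, neg_one_mul, neg_neg, one_pow]
  simp only [hermitePoly, evalReal_eq]
  rw [dirac_iterate_exp_smul]
  beta_reduce
  have hcancel : (-1) ^ l * Real.exp (‖x‖ ^ 2 / 2) * (Real.exp (-‖x‖ ^ 2 / 2) * (-1) ^ l) = 1 := by
    linear_combination (-1) ^ l * (-1) ^ l * hexp + hsign
  rw [map_smul, smul_smul, smul_smul, mul_assoc, hcancel, one_smul]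

theorem hermiteFunction_eq (l k : ℕ) (P : CliffordPoly m) (x : EuclideanSpace ℝ (Fin m)) :
    hermiteFunction l k P x = ((√(hermiteGamma m l k))⁻¹ * Real.exp (-‖x‖ ^ 2 / 4)) •
      applyReal (evalAt x) ((cliffOp gaussOp ^ l) P.toTensor) := by
  rw [hermiteFunction, hermitePoly_eq]

theorem cliffOp_partialOp_toTensor {k : ℕ} {P : CliffordPoly m} (hP : P ∈ monogenics m k) :
    cliffOp partialOp P.toTensor = 0 := by
  refine eq_of_applyReal_evalAt_eq fun x => ?_
  rw [← dirac_applyReal, map_zero, ← hP.2 x]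
  simp only [← evalReal_eq]

-- The square of the Dirac operator is minus the Laplacian.
theorem isHarmonic_of_mem_monogenics {k : ℕ} {P : CliffordPoly m} (hP : P ∈ monogenics m k)
    (A : Finset (Fin m)) : IsHarmonic k (P A) where
  homogeneous := hP.1 A
  laplace := by
    have hsquare := LinearMap.congr_fun (cliffOp_mul_self (m := m) partialOp_mul_comm) P.toTensor
    rw [Module.End.mul_apply, cliffOp_partialOp_toTensor hP, map_zero, LinearMap.neg_apply,
      zero_eq_neg] at hsquare
    have hcomponent := component_scalarOp A (∑ j, partialOp j * partialOp j) P.toTensor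
    rw [hsquare, map_zero, component_toTensor, LinearMap.sum_apply] at hcomponent
    exact hcomponent.symm

theorem isLowestWeight_of_mem_monogenics {T : Fin m → Module.End ℝ (ScalarPoly m)}
    (hT : ∀ {k : ℕ} {p : ScalarPoly m}, IsHarmonic k p → numberOp partialOp T p = (k : ℝ) • p)
    {k : ℕ} {P : CliffordPoly m} (hP : P ∈ monogenics m k) :
    IsLowestWeight (cliffOp partialOp) (scalarOp (numberOp partialOp T)) (k : ℝ) P.toTensor where
  lowering_eq := cliffOp_partialOp_toTensor hP
  number_eq := component_ext fun A => by
    rw [component_scalarOp, map_smul, component_toTensor, hT (isHarmonic_of_mem_monogenics hP A)]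

theorem pairing_fischerForm_eq {k : ℕ} {P Q : CliffordPoly m} (hP : P ∈ monogenics m k)
    (hQ : Q ∈ monogenics m k) : pairing (fischerForm m) P.toTensor Q.toTensor =
      pairing (gaussForm m) P.toTensor Q.toTensor := by
  refine pairing_congr fun A A' => ?_
  simp only [component_toTensor]
  exact IsHarmonic.form_eq isAdjointForm_fischerForm isAdjointForm_gaussForm
    (fischerForm_one_one.trans gaussForm_one_one.symm) (isHarmonic_of_mem_monogenics hP A)
    (isHarmonic_of_mem_monogenics hQ A')

theorem applyComplex_gaussFunctional {k : ℕ} {P : CliffordPoly m} (hP : P ∈ monogenics m k)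
    (z : Fin m → ℂ) : applyComplex (gaussFunctional z) P.toTensor = P.evalComplex z := by
  simp only [evalComplex_eq, cliffordExtension_eq_sum, component_toTensor, evalAtComplex_apply,
    (isHarmonic_of_mem_monogenics hP _).functional_eq_aeval (gaussFunctional_one z)
      (gaussFunctional_gaussOp z)]

theorem cexp_mul_exp_eq_gaussKernel (z : Fin m → ℂ) (x : EuclideanSpace ℝ (Fin m)) :
    Complex.exp (-(∑ j, z j * z j) / 2 + ∑ j, (x j : ℂ) * z j
      - (∑ j, (x j : ℂ) * (x j : ℂ)) / 4) * (Real.exp (-‖x‖ ^ 2 / 4) : ℝ) = gaussKernel z x := by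
  rw [Complex.ofReal_exp, ← Complex.exp_add, gaussKernel, EuclideanSpace.real_norm_sq_eq]
  congr 1
  push_cast
  simp only [sq]
  ring

theorem bargmann_hermiteFunction (l : ℕ) {k : ℕ} {P : CliffordPoly m} (hP : P ∈ monogenics m k)
    (z : Fin m → ℂ) : bargmann (hermiteFunction l k P) z =
      (√(hermiteGamma m l k))⁻¹ • vecPowMul l P z := by
  have hkernel (x : EuclideanSpace ℝ (Fin m)) :
      Complex.exp (-(∑ j, z j * z j) / 2 + ∑ j, (x j : ℂ) * z j
        - (∑ j, (x j : ℂ) * (x j : ℂ)) / 4) • complexify (hermiteFunction l k P x) =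
      (√(hermiteGamma m l k))⁻¹ • (gaussKernel z x •
        complexifyHom m (applyReal (evalAt x) ((cliffOp gaussOp ^ l) P.toTensor))) := by
    rw [complexify_eq, hermiteFunction_eq, map_smul, mul_smul, smul_comm,
      ← cexp_mul_exp_eq_gaussKernel, mul_smul, Complex.coe_smul]
  simp only [bargmann, hkernel]
  rw [integral_smul, smul_comm, integral_gaussKernel_smul, inv_smul_smul₀ (by positivity),
    applyComplex_cliffOp_pow (gaussFunctional_gaussOp z), applyComplex_gaussFunctional hP,
    vecPowMul]

theorem hermiteGamma_even (p k : ℕ) : hermiteGamma m (2 * p) k =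
    (2 : ℝ) ^ (2 * p + (m : ℝ) / 2 + k) * p.factorial * √Real.pi ^ m *
      Real.Gamma ((m : ℝ) / 2 + k + p) / Real.Gamma ((m : ℝ) / 2) := by
  simp only [hermiteGamma, even_two_mul, if_true, Nat.mul_div_cancel_left p two_pos]

theorem hermiteGamma_odd (p k : ℕ) : hermiteGamma m (2 * p + 1) k =
    (2 : ℝ) ^ (2 * p + (m : ℝ) / 2 + k + 1) * p.factorial * √Real.pi ^ m *
      Real.Gamma ((m : ℝ) / 2 + k + p + 1) / Real.Gamma ((m : ℝ) / 2) := by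
  have hhalf : (2 * p + 1) / 2 = p := by lia
  simp only [hermiteGamma, Nat.not_even_two_mul_add_one, if_false, hhalf]

theorem hermiteGamma_succ (hm : 1 ≤ m) (l k : ℕ) :
    hermiteGamma m (l + 1) k = lowerCoeff (m : ℝ) k (l + 1) * hermiteGamma m l k := by
  have : (0 : ℝ) < m := Nat.cast_pos.2 hm
  rcases Nat.even_or_odd' l with ⟨p, rfl | rfl⟩
  · rw [hermiteGamma_odd, hermiteGamma_even, lowerCoeff, if_neg (Nat.not_even_two_mul_add_one p),
      Real.Gamma_add_one (by positivity), Real.rpow_add_one (by norm_num)]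
    push_cast
    ring
  · have hnext : 2 * p + 1 + 1 = 2 * (p + 1) := by ring
    have hexp : 2 * ((p + 1 : ℕ) : ℝ) + (m : ℝ) / 2 + k = 2 * p + (m : ℝ) / 2 + k + 1 + 1 := by
      push_cast
      ring
    have harg : (m : ℝ) / 2 + k + ((p + 1 : ℕ) : ℝ) = (m : ℝ) / 2 + k + p + 1 := by
      push_cast
      ring
    rw [hnext, hermiteGamma_odd, hermiteGamma_even, lowerCoeff, if_pos (even_two_mul _),
      Nat.factorial_succ, hexp, Real.rpow_add_one (by norm_num) (_ + 1), harg]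
    push_cast
    ring

theorem hermiteGamma_eq (hm : 1 ≤ m) (l k : ℕ) :
    hermiteGamma m l k = lowerProd (m : ℝ) k l * hermiteGamma m 0 k := by
  induction l with
  | zero => rw [lowerProd, Finset.prod_range_zero, one_mul]
  | succ l ih =>
    rw [hermiteGamma_succ hm, ih, lowerProd, lowerProd, Finset.prod_range_succ, ← mul_assoc,
      mul_comm (lowerCoeff _ _ _)]

theorem hermiteGamma_pos (hm : 1 ≤ m) (l k : ℕ) : 0 < hermiteGamma m l k := by
  have hhalf : (0 : ℝ) < (m : ℝ) / 2 := by
    have : (0 : ℝ) < m := Nat.cast_pos.2 hm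
    positivity
  have := Real.Gamma_pos_of_pos hhalf
  rcases Nat.even_or_odd' l with ⟨p, rfl | rfl⟩
  · rw [hermiteGamma_even]
    have := Real.Gamma_pos_of_pos (s := (m : ℝ) / 2 + k + p) (by positivity)
    positivity
  · rw [hermiteGamma_odd]
    have := Real.Gamma_pos_of_pos (s := (m : ℝ) / 2 + k + p + 1) (by positivity)
    positivity

theorem hermiteGamma_zero (k : ℕ) : hermiteGamma m 0 k = √(2 * Real.pi) ^ m *
    (2 ^ k * Real.Gamma ((m : ℝ) / 2 + k) / Real.Gamma ((m : ℝ) / 2)) := by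
  have hsqrt : (2 : ℝ) ^ ((m : ℝ) / 2) = √2 ^ m := by
    rw [Real.sqrt_eq_rpow, ← Real.rpow_natCast, ← Real.rpow_mul (by norm_num)]
    congr 1
    ring
  have hzero := hermiteGamma_even (m := m) 0 k
  rw [mul_zero, Nat.cast_zero, mul_zero, zero_add, Nat.factorial_zero, Nat.cast_one, mul_one,
    add_zero, Real.rpow_add (by norm_num), Real.rpow_natCast, hsqrt] at hzero
  rw [hzero, Real.sqrt_mul (by norm_num), mul_pow]
  ring

end DiracOperator

/-! ### Polar coordinates and orthonormality -/

section PolarCoordinates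

theorem integral_volumeIoiPow {F : Type*} [NormedAddCommGroup F] [NormedSpace ℝ F] (n : ℕ)
    (g : ℝ → F) : ∫ r : Set.Ioi (0 : ℝ), g r ∂.volumeIoiPow n =
      ∫ r in Set.Ioi (0 : ℝ), r ^ n • g r := by
  simp only [Measure.volumeIoiPow, ENNReal.ofReal]
  rw [integral_withDensity_eq_integral_smul (measurable_subtype_coe.pow_const _).real_toNNReal,
    integral_subtype_comap measurableSet_Ioi fun r => Real.toNNReal (r ^ n) • g r]
  refine setIntegral_congr_fun measurableSet_Ioi fun r hr => ?_
  rw [NNReal.smul_def, Real.coe_toNNReal _ (pow_nonneg hr.out.le _)]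

theorem integral_pow_mul_exp_neg_sq (n : ℕ) :
    ∫ r in Set.Ioi (0 : ℝ), r ^ n * Real.exp (-r ^ 2 / 2) =
      2 ^ (((n : ℝ) + 1) / 2) * (1 / 2) * Real.Gamma (((n : ℝ) + 1) / 2) := by
  have hscale : (1 / 2 : ℝ) ^ (-((n : ℝ) + 1) / 2) = 2 ^ (((n : ℝ) + 1) / 2) := by
    rw [one_div, Real.inv_rpow zero_le_two, ← Real.rpow_neg zero_le_two, neg_div, neg_neg]
  rw [← hscale, ← integral_rpow_mul_exp_neg_mul_rpow two_pos
    (neg_one_lt_zero.trans_le n.cast_nonneg) one_half_pos]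
  refine setIntegral_congr_fun measurableSet_Ioi fun r _ => ?_
  have hexponent : -r ^ 2 / 2 = -(1 / 2) * r ^ 2 := by ring
  simp only [Real.rpow_natCast, Real.rpow_two, hexponent]

section Haar

variable {E F : Type*} [NormedAddCommGroup E] [NormedSpace ℝ E] [FiniteDimensional ℝ E]
  [MeasurableSpace E] [BorelSpace E] [Nontrivial E] [NormedAddCommGroup F] [NormedSpace ℝ F]
  (μ : Measure E) [μ.IsAddHaarMeasure] {f : E → F} {n : ℕ}

theorem integral_norm_smul_of_homogeneous (hf : ∀ (r : ℝ) x, f (r • x) = r ^ n • f x)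
    (g : ℝ → ℝ) : ∫ x, g ‖x‖ • f x ∂μ =
      (∫ r in Set.Ioi (0 : ℝ), r ^ (Module.finrank ℝ E - 1 + n) * g r) •
        ∫ x : Metric.sphere (0 : E) 1, f x ∂μ.toSphere := by
  have hpolar (x : ({(0)}ᶜ : Set E)) : f x = ‖x.1‖ ^ n • f (‖x.1‖⁻¹ • x.1) := by
    rw [← hf, smul_inv_smul₀ (norm_ne_zero_iff.2 x.2)]
  calc
    _ = ∫ x : ({(0)}ᶜ : Set E), g ‖x.1‖ • f x.1 ∂(μ.comap (↑)) := by
      rw [integral_subtype_comap (measurableSet_singleton _).compl fun x => g ‖x‖ • f x,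
        restrict_compl_singleton]
    _ = ∫ y : Metric.sphere (0 : E) 1 × Set.Ioi (0 : ℝ), (y.2.1 ^ n * g y.2.1) • f y.1
        ∂μ.toSphere.prod (.volumeIoiPow (Module.finrank ℝ E - 1)) := by
      rw [← μ.measurePreserving_homeomorphUnitSphereProd.integral_comp
        (Homeomorph.measurableEmbedding _)]
      refine integral_congr_ae (Filter.Eventually.of_forall fun x => ?_)
      simp only [homeomorphUnitSphereProd_apply_fst_coe, homeomorphUnitSphereProd_apply_snd_coe]
      rw [hpolar x, smul_smul, mul_comm]
    _ = (∫ r : Set.Ioi (0 : ℝ), r.1 ^ n * g r.1 ∂.volumeIoiPow (Module.finrank ℝ E - 1)) •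
        ∫ x : Metric.sphere (0 : E) 1, f x ∂μ.toSphere := by
      rw [← integral_prod_swap]
      exact integral_prod_smul (fun r : Set.Ioi (0 : ℝ) => r.1 ^ n * g r.1)
        (fun x : Metric.sphere (0 : E) 1 => f x)
    _ = _ := by
      rw [integral_volumeIoiPow _ fun r => r ^ n * g r]
      simp only [smul_eq_mul, pow_add, mul_assoc]

theorem integral_exp_norm_sq_smul_of_homogeneous
    (hf : ∀ (r : ℝ) x, f (r • x) = r ^ n • f x) :
    ∫ x, Real.exp (-‖x‖ ^ 2 / 2) • f x ∂μ =
      (2 ^ (((Module.finrank ℝ E : ℝ) + n) / 2) * (1 / 2) *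
        Real.Gamma (((Module.finrank ℝ E : ℝ) + n) / 2)) •
        ∫ x : Metric.sphere (0 : E) 1, f x ∂μ.toSphere := by
  have hdegree : ((Module.finrank ℝ E - 1 + n : ℕ) : ℝ) + 1 = Module.finrank ℝ E + n := by
    rw [← Nat.cast_add_one, ← Nat.cast_add]
    have := Module.finrank_pos (R := ℝ) (M := E)
    congr 1
    lia
  rw [integral_norm_smul_of_homogeneous μ hf fun r => Real.exp (-r ^ 2 / 2),
    integral_pow_mul_exp_neg_sq, hdegree]

end Haar

variable {m : ℕ}

theorem eval_smul_of_isHomogeneous {σ R : Type*} [CommSemiring R] {k : ℕ}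
    {p : MvPolynomial σ R} (hp : p.IsHomogeneous k) (r : R) (x : σ → R) :
    MvPolynomial.eval (r • x) p = r ^ k * MvPolynomial.eval x p := by
  rw [MvPolynomial.eval_eq, MvPolynomial.eval_eq, Finset.mul_sum]
  refine Finset.sum_congr rfl fun s hs => ?_
  have hdegree : ∑ j ∈ s.support, s j = k := by
    rw [← hp (MvPolynomial.mem_support_iff.1 hs), Finsupp.weight_apply, Finsupp.sum]
    simp only [Pi.one_apply, smul_eq_mul, mul_one]
  simp only [Pi.smul_apply, smul_eq_mul, mul_pow, Finset.prod_mul_distrib,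
    Finset.prod_pow_eq_pow_sum, hdegree, mul_left_comm]

theorem evalReal_smul {k : ℕ} {P : CliffordPoly m} (hP : ∀ A, (P A).IsHomogeneous k) (r : ℝ)
    (x : EuclideanSpace ℝ (Fin m)) : P.evalReal (r • x) = r ^ k • P.evalReal x := by
  simp only [CliffordPoly.evalReal, Finset.smul_sum, smul_smul]
  exact Finset.sum_congr rfl fun A _ => by
    rw [← eval_smul_of_isHomogeneous (hP A)]
    rfl

theorem integral_exp_norm_sq :
    ∫ x : EuclideanSpace ℝ (Fin m), Real.exp (-‖x‖ ^ 2 / 2) = √(2 * Real.pi) ^ m := by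
  simpa only [mul_one, evalAt_apply, map_one, gaussForm_one_one] using
    integral_exp_mul_evalAt (m := m) 1 1

theorem integral_exp_norm_sq_smul_eq_sphereMeasure (hm : 1 ≤ m) {F : Type*}
    [NormedAddCommGroup F] [NormedSpace ℝ F] {f : EuclideanSpace ℝ (Fin m) → F} {k : ℕ}
    (hf : ∀ (r : ℝ) x, f (r • x) = r ^ (2 * k) • f x) :
    ∫ x, Real.exp (-‖x‖ ^ 2 / 2) • f x =
      hermiteGamma m 0 k • ∫ x, f x ∂sphereMeasure m := by
  have : Nonempty (Fin m) := ⟨⟨0, hm⟩⟩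
  have hmass := integral_exp_norm_sq_smul_of_homogeneous
    (volume : Measure (EuclideanSpace ℝ (Fin m))) (f := fun _ => (1 : ℝ)) (n := 0)
    fun _ _ => by rw [pow_zero, one_smul]
  simp only [smul_eq_mul, mul_one, integral_exp_norm_sq, integral_const,
    finrank_euclideanSpace_fin, Nat.cast_zero, add_zero] at hmass
  set σ := (volume : Measure (EuclideanSpace ℝ (Fin m))).toSphere
  have hσ : σ.real Set.univ ≠ 0 :=
    right_ne_zero_of_mul (hmass ▸ (by positivity : √(2 * Real.pi) ^ m ≠ 0))
  have hmean : ∫ x, f x ∂sphereMeasure m = (σ.real Set.univ)⁻¹ •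
      ∫ x : Metric.sphere (0 : EuclideanSpace ℝ (Fin m)) 1, f x ∂σ := by
    rw [sphereMeasure, integral_smul_measure, ENNReal.toReal_inv, Measure.real]
  have hexponent : ((m : ℝ) + (2 * k : ℕ)) / 2 = (m : ℝ) / 2 + k := by
    push_cast
    ring
  have hGamma : Real.Gamma ((m : ℝ) / 2) ≠ 0 :=
    (Real.Gamma_pos_of_pos (half_pos (Nat.cast_pos.2 hm))).ne'
  rw [integral_exp_norm_sq_smul_of_homogeneous _ hf, finrank_euclideanSpace_fin, hexponent, hmean,
    smul_smul, hermiteGamma_zero, hmass, Real.rpow_add two_pos, Real.rpow_natCast]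
  congr 1
  field_simp

theorem pairing_gaussForm_eq_sphereInner (hm : 1 ≤ m) {k : ℕ} {P Q : CliffordPoly m}
    (hP : ∀ A, (P A).IsHomogeneous k) (hQ : ∀ A, (Q A).IsHomogeneous k) :
    √(2 * Real.pi) ^ m • pairing (gaussForm m) P.toTensor Q.toTensor =
      hermiteGamma m 0 k • sphereInner P Q := by
  rw [← integral_exp_smul_dagger_mul]
  simp only [← evalReal_eq]
  refine integral_exp_norm_sq_smul_eq_sphereMeasure hm fun r x => ?_
  rw [evalReal_smul hP, evalReal_smul hQ, dagger_smul, conj_trivial, smul_mul_smul_comm, two_mul,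
    pow_add]

end PolarCoordinates

section Orthonormality

variable {m : ℕ} {d : ℕ → ℕ} {P : (k : ℕ) → Fin (d k) → CliffordPoly m}

theorem pairing_pow_monogenicBasis (hm : 1 ≤ m) (hP : ∀ k, IsMonogenicBasis k (P k))
    {T : Fin m → Module.End ℝ (ScalarPoly m)} (hT : IsCanonicalPair partialOp T)
    (hN : ∀ {k : ℕ} {p : ScalarPoly m}, IsHarmonic k p → numberOp partialOp T p = (k : ℝ) • p)
    {B : ScalarPoly m →ₗ[ℝ] ScalarPoly m →ₗ[ℝ] ℝ} (hB : IsAdjointForm partialOp T B)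
    (hgauss : ∀ {k : ℕ} {P Q : CliffordPoly m}, P ∈ monogenics m k → Q ∈ monogenics m k →
      pairing B P.toTensor Q.toTensor = pairing (gaussForm m) P.toTensor Q.toTensor)
    (i i' : ℕ × (Σ k, Fin (d k))) :
    ((√(hermiteGamma m i.1 i.2.1))⁻¹ * (√(hermiteGamma m i'.1 i'.2.1))⁻¹ *
      √(2 * Real.pi) ^ m) •
      pairing B ((cliffOp T ^ i.1) (P i.2.1 i.2.2).toTensor)
        ((cliffOp T ^ i'.1) (P i'.2.1 i'.2.2).toTensor) = if i = i' then 1 else 0 := by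
  obtain ⟨l, k, j⟩ := i
  obtain ⟨l', k', j'⟩ := i'
  have hu := isLowestWeight_of_mem_monogenics hN ((hP k).mem j)
  have hv := isLowestWeight_of_mem_monogenics hN ((hP k').mem j')
  rw [hT.isLadder.form_raising_pow hB.isLadderForm hu.lowering_eq hv]
  by_cases hl : l = l'
  swap
  · rw [if_neg hl, smul_zero, if_neg fun h => hl (congrArg Prod.fst h)]
  subst hl
  by_cases hk : k = k'
  swap
  · rw [hT.isLadder.form_eq_zero_of_weight_ne hB.isLadderForm hu hv (Nat.cast_injective.ne hk),
      if_pos rfl, smul_zero, smul_zero, if_neg fun h => hk (congrArg (·.2.1) h)]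
  subst hk
  have hpos := hermiteGamma_pos hm l k
  have hnormalize : (√(hermiteGamma m l k))⁻¹ * (√(hermiteGamma m l k))⁻¹ *
      (lowerProd (m : ℝ) k l * hermiteGamma m 0 k) = 1 := by
    rw [← hermiteGamma_eq hm, ← mul_inv, Real.mul_self_sqrt hpos.le, inv_mul_cancel₀ hpos.ne']
  rw [if_pos rfl, hgauss ((hP k).mem j) ((hP k).mem j'), smul_smul, mul_right_comm,
    mul_smul _ (√(2 * Real.pi) ^ m),
    pairing_gaussForm_eq_sphereInner hm ((hP k).mem j).1 ((hP k).mem j').1, (hP k).orthonormal,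
    smul_smul, mul_assoc, hnormalize, one_smul]
  simp only [Prod.mk.injEq, Sigma.mk.injEq, heq_eq_eq, true_and]

theorem integral_hermiteFunction (hm : 1 ≤ m) (hP : ∀ k, IsMonogenicBasis k (P k))
    (i i' : ℕ × (Σ k, Fin (d k))) :
    ∫ x, dagger (hermiteFunction i.1 i.2.1 (P i.2.1 i.2.2) x) *
      hermiteFunction i'.1 i'.2.1 (P i'.2.1 i'.2.2) x = if i = i' then 1 else 0 := by
  rw [← pairing_pow_monogenicBasis hm hP isCanonicalPair_gaussOp IsHarmonic.numberOp_gaussOp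
    isAdjointForm_gaussForm (fun _ _ => rfl), mul_smul, ← integral_exp_smul_dagger_mul,
    ← integral_smul]
  refine integral_congr_ae (Filter.Eventually.of_forall fun x => ?_)
  have hexp : Real.exp (-‖x‖ ^ 2 / 2) = Real.exp (-‖x‖ ^ 2 / 4) * Real.exp (-‖x‖ ^ 2 / 4) := by
    rw [← Real.exp_add]
    ring_nf
  beta_reduce
  rw [hermiteFunction_eq, hermiteFunction_eq, dagger_smul, conj_trivial, smul_mul_smul_comm,
    smul_smul, hexp, mul_mul_mul_comm]

theorem integral_vecPowMul (hm : 1 ≤ m) (hP : ∀ k, IsMonogenicBasis k (P k))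
    (i i' : ℕ × (Σ k, Fin (d k))) :
    ∫ z, dagger (√(√(2 * Real.pi) ^ m / hermiteGamma m i.1 i.2.1) •
        vecPowMul i.1 (P i.2.1 i.2.2) z) *
      (√(√(2 * Real.pi) ^ m / hermiteGamma m i'.1 i'.2.1) •
        vecPowMul i'.1 (P i'.2.1 i'.2.2) z) ∂fockMeasure m = if i = i' then 1 else 0 := by
  have hpairing := congrArg (complexifyHom m) (pairing_pow_monogenicBasis hm hP
    isCanonicalPair_varOp IsHarmonic.numberOp_varOp isAdjointForm_fischerForm
    pairing_fischerForm_eq i i')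
  rw [map_smul, ← integral_dagger_applyComplex_mul, ← integral_smul, apply_ite (complexifyHom m),
    map_one, map_zero] at hpairing
  rw [← hpairing]
  refine integral_congr_ae (Filter.Eventually.of_forall fun z => ?_)
  have hsqrt : √(√(2 * Real.pi) ^ m) * √(√(2 * Real.pi) ^ m) = √(2 * Real.pi) ^ m :=
    Real.mul_self_sqrt (by positivity)
  beta_reduce
  rw [dagger_real_smul, smul_mul_smul_comm, vecPowMul_eq, vecPowMul_eq,
    Real.sqrt_div (by positivity), Real.sqrt_div (by positivity), div_mul_div_comm, hsqrt,
    div_eq_inv_mul, mul_inv]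

end Orthonormality

/-! ### Orthonormal bases of Hilbert Clifford modules -/

section HilbertModule

theorem hasSum_inner_smul_of_mem_closure_span {𝕜 H ι : Type*} [RCLike 𝕜] [NormedAddCommGroup H]
    [InnerProductSpace 𝕜 H] [CompleteSpace H] {v : ι → H} (hv : Orthonormal 𝕜 v) {x : H}
    (hx : x ∈ (Submodule.span 𝕜 (Set.range v)).topologicalClosure) :
    HasSum (fun i => inner 𝕜 (v i) x • v i) x := by
  set K := (Submodule.span 𝕜 (Set.range v)).topologicalClosure
  have hvK (i : ι) : v i ∈ K :=
    Submodule.le_topologicalClosure _ (Submodule.subset_span (Set.mem_range_self i))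
  have : CompleteSpace K := (Submodule.isClosed_topologicalClosure _).completeSpace_coe
  let w : ι → K := Set.codRestrict v K hvK
  have hspan : Subtype.val '' (Submodule.span 𝕜 (Set.range w) : Set K) =
      Submodule.span 𝕜 (Set.range v) := by
    rw [← Submodule.coe_subtype, ← Submodule.map_coe, Submodule.map_span, ← Set.range_comp]
    rfl
  have hdense : ⊤ ≤ (Submodule.span 𝕜 (Set.range w)).topologicalClosure := fun y _ =>
    closure_subtype.2 (hspan ▸ y.2)
  have hsum := (HilbertBasis.mk (hv.codRestrict K hvK) hdense).hasSum_repr ⟨x, hx⟩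
  simpa only [HilbertBasis.repr_apply_apply, HilbertBasis.coe_mk, map_smul,
    Submodule.subtypeL_apply, Submodule.coe_inner, Set.val_codRestrict_apply] using
    hsum.mapL K.subtypeL

variable {m : ℕ} {X : Type} [MeasurableSpace X] {μ : Measure X} {I : Type}

theorem isOrthonormalFamily_toLp [DecidableEq I] {𝕜 : Type} [RCLike 𝕜] [NormedSpace ℝ (Cl 𝕜 m)]
    {f : I → X → Cl 𝕜 m} (hf : ∀ i, MemLp (f i) 2 μ)
    (horth : ∀ i j, ∫ x, dagger (f i x) * f j x ∂μ = if i = j then 1 else 0) :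
    IsOrthonormalFamily fun i => (hf i).toLp (f i) := by
  intro i j
  rw [← horth i j]
  refine integral_congr_ae ?_
  filter_upwards [(hf i).coeFn_toLp, (hf j).coeFn_toLp] with x hi hj
  rw [hi, hj]

instance : CompleteSpace (Cl ℂ m) := FiniteDimensional.complete ℂ (Cl ℂ m)

/-- The inner product on the Clifford algebra that is given by the scalar part of `a† b`. It induces
the given norm, and hence turns the right module `L²` into a Hilbert space. -/
abbrev scalarInnerProductSpace (m : ℕ) : InnerProductSpace ℂ (Cl ℂ m) where
  toNormedSpace := inferInstance
  inner a b := scalarPart ℂ m (dagger a * b)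
  norm_sq_eq_re_inner a := by
    rw [norm_sq_eq, scalarPart_dagger_mul, map_sum]
    refine Finset.sum_congr rfl fun A _ => ?_
    rw [Complex.conj_mul', ← Complex.ofReal_pow]
    rfl
  conj_inner_symm a b := by
    simp only [scalarPart_dagger_mul, map_sum, map_mul, Complex.conj_conj, mul_comm]
  add_left a b c := by rw [dagger_add, add_mul, map_add]
  smul_left a b c := by rw [dagger_smul, smul_mul_assoc, map_smul, smul_eq_mul]

/-- The coefficient of a blade as a continuous linear functional. -/
def coeffCLM (A : Finset (Fin m)) : Cl ℂ m →L[ℂ] ℂ :=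
  LinearMap.toContinuousLinearMap ((bladeBasis ℂ m).coord A)

theorem coeffCLM_apply (A : Finset (Fin m)) (a : Cl ℂ m) :
    coeffCLM A a = (bladeBasis ℂ m).repr a A := rfl

theorem dagger_mul_eq_sum (a b : Cl ℂ m) : dagger a * b =
    ∑ A, ∑ A', (starRingEnd ℂ (coeffCLM A a) * coeffCLM A' b) •
      (dagger (blade ℂ A) * blade ℂ A') := by
  conv_lhs => rw [← sum_repr_smul_blade a, ← sum_repr_smul_blade b, ← daggerₗ_apply, map_sum,
    Finset.sum_mul_sum]
  simp only [daggerₗ_apply, dagger_smul, smul_mul_smul_comm, coeffCLM_apply]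

theorem integrable_dagger_mul (F G : Lp (Cl ℂ m) 2 μ) :
    Integrable (fun x => dagger (F x) * G x) μ := by
  have hcoeff (F : Lp (Cl ℂ m) 2 μ) (A : Finset (Fin m)) :
      MemLp (fun x => coeffCLM A (F x)) 2 μ := (coeffCLM A).comp_memLp' (Lp.memLp F)
  rw [funext fun x => dagger_mul_eq_sum (F x) (G x)]
  exact integrable_finsetSum _ fun A _ => integrable_finsetSum _ fun A' _ =>
    ((hcoeff F A).star.integrable_mul (hcoeff G A')).smul_const _

theorem coeFn_rightMul (F : Lp (Cl ℂ m) 2 μ) (a : Cl ℂ m) :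
    rightMul F a =ᵐ[μ] fun x => F x * a :=
  (mulRightCLM a).coeFn_compLp' F

theorem rightMul_one (F : Lp (Cl ℂ m) 2 μ) : rightMul F 1 = F :=
  Lp.ext <| (coeFn_rightMul F 1).trans <| Filter.Eventually.of_forall fun x => mul_one (F x)

/-- The map `a ↦ F a` into the right module `L²`. -/
def rightMulₗ (F : Lp (Cl ℂ m) 2 μ) : Cl ℂ m →ₗ[ℂ] Lp (Cl ℂ m) 2 μ where
  toFun := rightMul F
  map_add' a b := by
    refine Lp.ext ?_
    filter_upwards [coeFn_rightMul F (a + b), coeFn_rightMul F a, coeFn_rightMul F b,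
      Lp.coeFn_add (rightMul F a) (rightMul F b)] with x hab ha hb hadd
    rw [hab, hadd, Pi.add_apply, ha, hb, mul_add]
  map_smul' c a := by
    refine Lp.ext ?_
    filter_upwards [coeFn_rightMul F (c • a), coeFn_rightMul F a,
      Lp.coeFn_smul c (rightMul F a)] with x hca ha hsmul
    rw [hca, RingHom.id_apply, hsmul, Pi.smul_apply, ha, mul_smul_comm]

theorem rightMul_eq_sum (F : Lp (Cl ℂ m) 2 μ) (a : Cl ℂ m) :
    rightMul F a = ∑ A, (bladeBasis ℂ m).repr a A • rightMul F (blade ℂ A) := by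
  change rightMulₗ F a = ∑ A, (bladeBasis ℂ m).repr a A • rightMulₗ F (blade ℂ A)
  conv_lhs => rw [← sum_repr_smul_blade a]
  simp only [map_sum, map_smul]

theorem eq_sum_rightMul {J : Type*} [Fintype J] {F : Lp (Cl ℂ m) 2 μ} {Ψ : J → Lp (Cl ℂ m) 2 μ}
    {f : J → X → Cl ℂ m} {a : J → Cl ℂ m} {c : ℝ} (hc : c ≠ 0)
    (hΨ : ∀ j, Ψ j =ᵐ[μ] fun x => c • f j x) (hF : F =ᵐ[μ] fun x => ∑ j, f j x * a j) :
    F = ∑ j, rightMul (Ψ j) (c⁻¹ • a j) := by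
  have hterm (j : J) : rightMul (Ψ j) (c⁻¹ • a j) =ᵐ[μ] fun x => f j x * a j := by
    filter_upwards [coeFn_rightMul (Ψ j) (c⁻¹ • a j), hΨ j] with x hmul hx
    rw [hmul, hx, smul_mul_smul_comm, mul_inv_cancel₀ hc, one_smul]
  refine Lp.ext ?_
  filter_upwards [hF, ae_all_iff.2 hterm,
    Lp.coeFn_finsetSum Finset.univ fun j => rightMul (Ψ j) (c⁻¹ • a j)] with x hx hterms hsum
  rw [hx, hsum, Finset.sum_apply]
  exact Finset.sum_congr rfl fun j _ => (hterms j).symm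

theorem cliffordInner_rightMul (F G : Lp (Cl ℂ m) 2 μ) (a : Cl ℂ m) :
    cliffordInner μ F (rightMul G a) = cliffordInner μ F G * a := by
  refine Eq.trans (integral_congr_ae ?_)
    ((mulRightCLM a).integral_comp_comm (integrable_dagger_mul F G))
  filter_upwards [coeFn_rightMul G a] with x hx
  rw [hx, ← mul_assoc]
  rfl

/-- The right submodule generated by a family in `L²`, as the complex span of the products of its
members with the blades. -/
def rightSpan (Ψ : I → Lp (Cl ℂ m) 2 μ) : Submodule ℂ (Lp (Cl ℂ m) 2 μ) :=
  Submodule.span ℂ (Set.range fun p : I × Finset (Fin m) => rightMul (Ψ p.1) (blade ℂ p.2))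

theorem rightMul_mem_rightSpan (Ψ : I → Lp (Cl ℂ m) 2 μ) (i : I) (a : Cl ℂ m) :
    rightMul (Ψ i) a ∈ rightSpan Ψ := by
  rw [rightMul_eq_sum]
  exact Submodule.sum_mem _ fun A _ =>
    Submodule.smul_mem _ _ (Submodule.subset_span ⟨(i, A), rfl⟩)

attribute [local instance] scalarInnerProductSpace

theorem inner_rightMul_blade (F G : Lp (Cl ℂ m) 2 μ) (A : Finset (Fin m)) :
    inner ℂ (rightMul F (blade ℂ A)) G = (bladeBasis ℂ m).repr (cliffordInner μ F G) A := by
  rw [L2.inner_def]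
  refine Eq.trans (integral_congr_ae ?_)
    ((coeffCLM A).integral_comp_comm (integrable_dagger_mul F G))
  filter_upwards [coeFn_rightMul F (blade ℂ A)] with x hx
  change scalarPart ℂ m (dagger (rightMul F (blade ℂ A) x) * G x) = _
  rw [hx, dagger_mul, mul_assoc, scalarPart_dagger_blade_mul, coeffCLM_apply]

variable [DecidableEq I] {Ψ : I → Lp (Cl ℂ m) 2 μ}

theorem orthonormal_rightMul_blade (hΨ : IsOrthonormalFamily Ψ) :
    Orthonormal ℂ fun p : I × Finset (Fin m) => rightMul (Ψ p.1) (blade ℂ p.2) := by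
  rw [orthonormal_iff_ite]
  rintro ⟨i, A⟩ ⟨j, A'⟩
  rw [inner_rightMul_blade, cliffordInner_rightMul, hΨ i j]
  by_cases hij : i = j
  · simp only [hij, if_true, one_mul, repr_blade, Finsupp.single_apply, Prod.mk.injEq, true_and,
      eq_comm]
  · simp only [hij, if_false, zero_mul, map_zero, Finsupp.coe_zero, Pi.zero_apply, Prod.mk.injEq,
      false_and]

theorem isOrthonormalBasis_closure_rightSpan (hΨ : IsOrthonormalFamily Ψ) :
    IsOrthonormalBasis (rightSpan Ψ).topologicalClosure Ψ where
  mem i := Submodule.le_topologicalClosure _ <| by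
    simpa only [rightMul_one] using rightMul_mem_rightSpan Ψ i 1
  orthonormal := hΨ
  hasSum F hF := by
    refine (hasSum_inner_smul_of_mem_closure_span
      (orthonormal_rightMul_blade hΨ) hF).prod_fiberwise fun i => ?_
    rw [rightMul_eq_sum]
    simp only [inner_rightMul_blade]
    exact hasSum_fintype _

end HilbertModule

/-! ### The bases of the two Hilbert modules -/

section Bases

variable {m : ℕ}

theorem continuous_evalAtComplex (p : ScalarPoly m) :
    Continuous fun z : Fin m → ℂ => evalAtComplex z p := by
  simp only [evalAtComplex_apply, MvPolynomial.aeval_def, MvPolynomial.eval₂_eq_eval_map]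
  exact MvPolynomial.continuous_eval _

theorem memLp_evalAtComplex (p : ScalarPoly m) :
    MemLp (fun z : Fin m → ℂ => evalAtComplex z p) 2 (fockMeasure m) := by
  rw [memLp_two_iff_integrable_sq_norm (continuous_evalAtComplex p).aestronglyMeasurable]
  refine (integrable_conj_evalAtComplex_mul p p).norm.congr <|
    Filter.Eventually.of_forall fun z => ?_
  simp only [norm_mul, RCLike.norm_conj, sq]

theorem memLp_vecPowMul (l : ℕ) (P : CliffordPoly m) :
    MemLp (vecPowMul l P) 2 (fockMeasure m) := by
  simp only [funext (vecPowMul_eq l P), cliffordExtension_eq_sum]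
  exact memLp_finsetSum _ fun A _ =>
    (ContinuousLinearMap.toSpanSingleton ℂ _).comp_memLp' (memLp_evalAtComplex _)

theorem memLp_exp_mul_evalAt (p : ScalarPoly m) :
    MemLp (fun x : EuclideanSpace ℝ (Fin m) => Real.exp (-‖x‖ ^ 2 / 4) * evalAt x p) 2 := by
  have hcont : Continuous fun x : EuclideanSpace ℝ (Fin m) =>
      Real.exp (-‖x‖ ^ 2 / 4) * evalAt x p := by
    simp only [evalAt_apply]
    exact Continuous.mul (by fun_prop)
      ((MvPolynomial.continuous_eval p).comp (PiLp.continuous_ofLp 2 _))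
  rw [memLp_two_iff_integrable_sq_norm hcont.aestronglyMeasurable]
  refine (integrable_exp_mul_evalAt (p * p)).congr (Filter.Eventually.of_forall fun x => ?_)
  have hexp : Real.exp (-‖x‖ ^ 2 / 2) = Real.exp (-‖x‖ ^ 2 / 4) ^ 2 := by
    rw [← Real.exp_nat_mul]
    push_cast
    ring_nf
  simp only [evalAt_apply, map_mul, Real.norm_eq_abs, sq_abs, hexp]
  ring

theorem memLp_hermiteFunction (l k : ℕ) (P : CliffordPoly m) :
    MemLp (hermiteFunction l k P) 2 (volume : Measure (EuclideanSpace ℝ (Fin m))) := by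
  have hsum : hermiteFunction l k P = fun x => ∑ A, ((√(hermiteGamma m l k))⁻¹ *
      (Real.exp (-‖x‖ ^ 2 / 4) * evalAt x (component A ((cliffOp gaussOp ^ l) P.toTensor)))) •
        blade ℝ A := by
    funext x
    simp only [hermiteFunction_eq, cliffordExtension_eq_sum, AlgHom.id_apply, Finset.smul_sum,
      smul_smul, mul_assoc]
  rw [hsum]
  exact memLp_finsetSum _ fun A _ => (ContinuousLinearMap.toSpanSingleton ℝ _).comp_memLp'
    ((memLp_exp_mul_evalAt _).const_mul _)

theorem vecPowMul_eq_sum {J : Type*} [Fintype J] {P : J → CliffordPoly m} {Q : CliffordPoly m}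
    {a : J → Cl ℝ m} (h : ∀ x, Q.evalReal x = ∑ j, (P j).evalReal x * a j) (l : ℕ)
    (z : Fin m → ℂ) : vecPowMul l Q z = ∑ j, vecPowMul l (P j) z * complexifyHom m (a j) := by
  have hQ : Q.toTensor = ∑ j, mulRightOp (a j) (P j).toTensor := by
    refine eq_of_applyReal_evalAt_eq fun x => ?_
    rw [← evalReal_eq, h, map_sum]
    simp only [cliffordExtension_mulRightOp, AlgHom.id_apply, evalReal_eq]
  simp only [vecPowMul, mul_assoc, ← Finset.mul_sum]
  rw [evalComplex_eq, hQ, map_sum]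
  simp only [cliffordExtension_mulRightOp, evalComplex_eq]

variable {d : ℕ → ℕ} {P : (k : ℕ) → Fin (d k) → CliffordPoly m}

theorem segalBargmannModule_eq_closure_rightSpan (hP : ∀ k, IsMonogenicBasis k (P k))
    {c : ℕ → ℕ → ℝ} (hc : ∀ l k, c l k ≠ 0)
    {Ψ : ℕ × (Σ k, Fin (d k)) → Lp (Cl ℂ m) 2 (fockMeasure m)}
    (hΨ : ∀ l k j, Ψ (l, ⟨k, j⟩) =ᵐ[fockMeasure m] fun z => c l k • vecPowMul l (P k j) z) :
    segalBargmannModule m = (rightSpan Ψ).topologicalClosure := by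
  rw [segalBargmannModule]
  congr 1
  refine le_antisymm (Submodule.span_le.2 ?_) (Submodule.span_le.2 ?_)
  · rintro F ⟨l, k, Q, a, hQ, hF⟩
    obtain ⟨b, hb⟩ := (hP k).span Q hQ
    simp only [vecPowMul_eq_sum hb, Finset.sum_mul, mul_assoc] at hF
    rw [eq_sum_rightMul (hc l k) (hΨ l k) hF]
    exact Submodule.sum_mem _ fun j _ => rightMul_mem_rightSpan Ψ _ _
  · rintro _ ⟨⟨⟨l, k, j⟩, A⟩, rfl⟩
    refine Submodule.subset_span ⟨l, k, P k j, c l k • blade ℂ A, (hP k).mem j, ?_⟩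
    filter_upwards [coeFn_rightMul (Ψ (l, ⟨k, j⟩)) (blade ℂ A), hΨ l k j] with z hmul hz
    rw [hmul, hz, smul_mul_assoc, mul_smul_comm]

end Bases

end SegalBargmann

end

theorem corollary5p4 (m : ℕ) (hm : 1 ≤ m) (d : ℕ → ℕ)
    (P : (k : ℕ) → Fin (d k) → CliffordPoly m) (hP : ∀ k, IsMonogenicBasis k (P k)) :
    (∃ Ψ : ℕ × (Σ k, Fin (d k)) → Lp (Cl ℂ m) 2 (fockMeasure m),
      (∀ l k j, Ψ (l, ⟨k, j⟩) =ᵐ[fockMeasure m] fun z =>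
        √(√(2 * Real.pi) ^ m / hermiteGamma m l k) • vecPowMul l (P k j) z) ∧
      (∀ l k j, Ψ (l, ⟨k, j⟩) =ᵐ[fockMeasure m] fun z =>
        √(√(2 * Real.pi) ^ m) • bargmann (hermiteFunction l k (P k j)) z) ∧
      IsOrthonormalBasis (segalBargmannModule m) Ψ) ∧
    (∃ Φ : ℕ × (Σ k, Fin (d k)) →
        Lp (Cl ℝ m) 2 (volume : Measure (EuclideanSpace ℝ (Fin m))),
      (∀ l k j, Φ (l, ⟨k, j⟩) =ᵐ[volume] hermiteFunction l k (P k j)) ∧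
      IsOrthonormalFamily Φ) ∧
    ∀ l k j z, bargmann (hermiteFunction l k (P k j)) z =
      (√(hermiteGamma m l k))⁻¹ • vecPowMul l (P k j) z := by
  have hΨ (i : ℕ × Σ k, Fin (d k)) : MemLp (fun z => √(√(2 * Real.pi) ^ m /
      hermiteGamma m i.1 i.2.1) • vecPowMul i.1 (P i.2.1 i.2.2) z) 2 (fockMeasure m) :=
    (memLp_vecPowMul _ _).const_smul _
  have hΦ (i : ℕ × Σ k, Fin (d k)) := memLp_hermiteFunction i.1 i.2.1 (P i.2.1 i.2.2)
  have hbargmann l k j z := bargmann_hermiteFunction l ((hP k).mem j) z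
  let Ψ : ℕ × (Σ k, Fin (d k)) → Lp (Cl ℂ m) 2 (fockMeasure m) := fun i => (hΨ i).toLp _
  have hvalues l k j : Ψ (l, ⟨k, j⟩) =ᵐ[fockMeasure m] _ := (hΨ (l, ⟨k, j⟩)).coeFn_toLp
  have hnormalization l k : √(√(2 * Real.pi) ^ m / hermiteGamma m l k) ≠ 0 :=
    (Real.sqrt_pos.2 (div_pos (by positivity) (hermiteGamma_pos hm l k))).ne'
  refine ⟨⟨Ψ, hvalues, fun l k j => ?_, ?_⟩,
    ⟨fun i => (hΦ i).toLp _, fun l k j => (hΦ (l, ⟨k, j⟩)).coeFn_toLp,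
      isOrthonormalFamily_toLp hΦ (integral_hermiteFunction hm hP)⟩, hbargmann⟩
  · refine (hvalues l k j).trans (Filter.Eventually.of_forall fun z => ?_)
    beta_reduce
    rw [hbargmann, smul_smul, ← div_eq_mul_inv, ← Real.sqrt_div (by positivity)]
  · rw [segalBargmannModule_eq_closure_rightSpan hP hnormalization hvalues]
    exact isOrthonormalBasis_closure_rightSpan
      (isOrthonormalFamily_toLp hΨ (integral_vecPowMul hm hP))
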